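/- Let $n,d,r$ be positive integers. Consider bipartite multigraphs with color classes $U=\{u_1<\dots<u_n\}$ and $V=\{v_1<\dots<v_n\}$, parallel edges between the same two vertices being undistinguished (so that a multigraph is given by its edge multiplicities). Two edges $uv$ and $u'v'$ cross if ($u<u'$ and $v'<v$) or ($u'<u$ and $v<v'$); in particular, edges that share an endpoint, or are parallel, do not cross. Let $\hat g_r(n;d)$ be the number of $r$-regular bipartite multigraphs on $U$ and $V$ in which every set of pairwise non-crossing edges (which may share endpoints, parallel edges being counted separately) has at most $d$ edges. (1) $\hat g_r(n;d)$ equals the number of ordered pairs $(P,Q)$ of standard Young tableaux of the same shape, with entries $1,\dots,rn$ (each used exactly once) and at most $d$ columns, such that both $P$ and $Q$ satisfy the following condition $(\hat T)$: for all $1\le i\le n$ and $1\le s<r$, the row containing $r(i-1)+s+1$ is weakly above the row containing $r(i-1)+s$. (2) Moreover, $$\hat g_r(n;d)=\sum_{\pi\in S_d}\operatorname{sign}(\pi)\,\bigl|\widehat W'(d,2rn;T(\pi))\bigr|,$$ where $T(\pi)=(1-\pi(1),\dots,d-\pi(d))$ and $\widehat W'(d,2rn;T(\pi))$ is the set of lattice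 walks in $\mathbb Z^d$ of length $2rn$ (each step being $\pm$ a standard basis vector) from the origin to $T(\pi)$ that consist of $rn$ positive steps, in directions $a_1,\dots,a_{rn}\in\{1,\dots,d\}$, followed by $rn$ negative steps, in directions $b_1,\dots,b_{rn}\in\{1,\dots,d\}$, such that both direction sequences are strictly increasing inside each of the $n$ consecutive blocks of length $r$: $a_{r(i-1)+s}<a_{r(i-1)+s+1}$ and $b_{r(i-1)+s}<b_{r(i-1)+s+1}$ for all $1\le i\le n$ and $1\le s<r$. -/

import Mathlib

namespace PlanarSubgraph

section Multigraphs

variable {U V : Type*}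

/-- A bipartite multigraph with color classes `U` and `V`: a multiset of pairs `(u, v)`.
Parallel edges are recorded by their multiplicity. -/
abbrev BipartiteMultigraph (U V : Type*) := Multiset (U × V)

/-- Every vertex of both color classes has degree `r` (edges counted with multiplicity). -/
def IsRegular [DecidableEq U] [DecidableEq V] (r : ℕ) (G : BipartiteMultigraph U V) : Prop :=
  (∀ u : U, (G.filter fun e => e.1 = u).card = r) ∧
    ∀ v : V, (G.filter fun e => e.2 = v).card = r

/-- Two edges cross if their endpoints appear in opposite strict orders in `U` and in `V`.
Edges that share an endpoint, in particular parallel edges, do not cross. -/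
def Crossing [LinearOrder U] [LinearOrder V] (e f : U × V) : Prop :=
  (e.1 < f.1 ∧ f.2 < e.2) ∨ (f.1 < e.1 ∧ e.2 < f.2)

/-- A set of edges (with multiplicity) no two of which cross. The edges may share endpoints. -/
def IsPlanar [LinearOrder U] [LinearOrder V] (S : BipartiteMultigraph U V) : Prop :=
  ∀ e ∈ S, ∀ f ∈ S, ¬ Crossing e f

/-- Every planar subgraph of `G` has at most `d` edges. -/
def PlanarSubgraphsAtMost [LinearOrder U] [LinearOrder V] (d : ℕ)
    (G : BipartiteMultigraph U V) : Prop :=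
  ∀ S : BipartiteMultigraph U V, S ≤ G → IsPlanar S → S.card ≤ d

end Multigraphs

/-- The number of `r`-regular bipartite multigraphs on two ordered color classes of size `n`
all of whose planar subgraphs have at most `d` edges. -/
noncomputable def gHat (r n d : ℕ) : ℕ :=
  {G : BipartiteMultigraph (Fin n) (Fin n) | IsRegular r G ∧ PlanarSubgraphsAtMost d G}.ncard

/-- A standard Young tableau whose set of entries is `S`, each element of `S` being used exactly
once. As the entries are distinct, the rows, which are weakly increasing in a semistandard
tableau, are strictly increasing. -/
structure YoungTableau (S : Finset ℕ) where
  shape : YoungDiagram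
  filling : SemistandardYoungTableau shape
  bijOn : Set.BijOn (fun c : ℕ × ℕ => filling c.1 c.2) (shape.cells : Set (ℕ × ℕ)) (S : Set ℕ)

namespace YoungTableau

variable {S : Finset ℕ}

/-- The number of columns, i.e. the length of the first row. -/
def numCols (T : YoungTableau S) : ℕ := T.shape.rowLen 0

/-- The entry `x` lies in the row with index `k` (the top row has index `0`). -/
def InRow (T : YoungTableau S) (x k : ℕ) : Prop :=
  ∃ j : ℕ, (k, j) ∈ T.shape ∧ T.filling k j = x

/-- In each block `r(i-1)+1, …, r(i-1)+r` (`1 ≤ i ≤ n`), the row that contains `r(i-1)+s+1` is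
weakly above the row that contains `r(i-1)+s`, for `1 ≤ s < r`. -/
def BlockCondition (r n : ℕ) (T : YoungTableau S) : Prop :=
  ∀ i s : ℕ, 1 ≤ i → i ≤ n → 1 ≤ s → s < r → ∀ k l : ℕ,
    T.InRow (r * (i - 1) + s + 1) k → T.InRow (r * (i - 1) + s) l → k ≤ l

end YoungTableau

/-- The pairs of standard Young tableaux of equal shape with entries `1, …, rn` and at most `d`
columns, both of which satisfy the block condition. -/
def tableauPairs (r n d : ℕ) :
    Set (YoungTableau (Finset.Icc 1 (r * n)) × YoungTableau (Finset.Icc 1 (r * n))) :=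
  {PQ | PQ.1.shape = PQ.2.shape ∧ PQ.1.numCols ≤ d ∧ PQ.2.numCols ≤ d ∧
    PQ.1.BlockCondition r n ∧ PQ.2.BlockCondition r n}

section Walks

variable {d m : ℕ}

/-- The `i`-th step of a sequence of lattice points. -/
def step (w : Fin (m + 1) → Fin d → ℤ) (i : Fin m) : Fin d → ℤ :=
  w i.succ - w i.castSucc

/-- The set `W(d, m; p)` of lattice walks of length `m` in `ℤ^d` from the origin to `p`:
consecutive points are at `ℓ¹`-distance one. -/
def walks (d m : ℕ) (p : Fin d → ℤ) : Set (Fin (m + 1) → Fin d → ℤ) :=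
  {w | w 0 = 0 ∧ w (Fin.last m) = p ∧ ∀ i : Fin m, ∑ k, |step w i k| = 1}

/-- The `i`-th step is a positive step in direction `k`. -/
def IsPosStep (w : Fin (m + 1) → Fin d → ℤ) (i : Fin m) (k : Fin d) : Prop :=
  step w i = Pi.single k 1

/-- The `i`-th step is a negative step in direction `k`. -/
def IsNegStep (w : Fin (m + 1) → Fin d → ℤ) (i : Fin m) (k : Fin d) : Prop :=
  step w i = -Pi.single k 1

/-- The set `W*(d, m; p)` of the walks in `W(d, m; p)` whose positive steps precede their
negative steps. -/
def sortedWalks (d m : ℕ) (p : Fin d → ℤ) : Set (Fin (m + 1) → Fin d → ℤ) :=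
  {w | w ∈ walks d m p ∧
    ∀ (i j : Fin m) (k l : Fin d), IsPosStep w i k → IsNegStep w j l → i < j}

end Walks

theorem index_lt {r n : ℕ} (i : Fin n) (s : Fin r) : r * i.1 + s.1 < r * n :=
  calc r * i.1 + s.1 < r * i.1 + r := Nat.add_lt_add_left s.2 _
    _ = r * (i.1 + 1) := rfl
    _ ≤ r * n := Nat.mul_le_mul_left r i.2

/-- The position, in a walk of length `2rn`, of the `s`-th step of the `i`-th block of the first
half of the walk. -/
def firstHalf {r n : ℕ} (i : Fin n) (s : Fin r) : Fin (2 * (r * n)) :=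
  ⟨r * i.1 + s.1, by have := index_lt i s; omega⟩

/-- The position, in a walk of length `2rn`, of the `s`-th step of the `i`-th block of the second
half of the walk. -/
def secondHalf {r n : ℕ} (i : Fin n) (s : Fin r) : Fin (2 * (r * n)) :=
  ⟨r * n + (r * i.1 + s.1), by have := index_lt i s; omega⟩

/-- The walks in `W*(d, 2rn; p)` that consist of `rn` positive steps in directions `a i s`
followed by `rn` negative steps in directions `b i s` (`i` is the block and `s` the place in
the block), where `a` and `b` are strictly increasing within each block. -/
def blockIncreasingWalks (d r n : ℕ) (p : Fin d → ℤ) :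
    Set (Fin (2 * (r * n) + 1) → Fin d → ℤ) :=
  {w | w ∈ sortedWalks d (2 * (r * n)) p ∧ ∃ a b : Fin n → Fin r → Fin d,
    (∀ i s, IsPosStep w (firstHalf i s) (a i s)) ∧
    (∀ i s, IsNegStep w (secondHalf i s) (b i s)) ∧
    (∀ i, StrictMono (a i)) ∧ ∀ i, StrictMono (b i)}

/-- The Toeplitz point `(1 - π(1), …, d - π(d))`. Numbering from `0` gives the same point. -/
def toeplitzPoint {d : ℕ} (π : Equiv.Perm (Fin d)) : Fin d → ℤ :=
  fun k => (k.1 : ℤ) - ((π k).1 : ℤ)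

end PlanarSubgraph

/-!
Both counts are compared with a third one, that of `dominantPairs r n d`: pairs of sequences
`S, R` of `n` sets of `r` columns out of `d`, such that the column heights (`content`) after each
block form a Young diagram, with equal final heights. Each sequence is a chain of `n` horizontal
strips of size `r`, recorded by the columns of the strips, that is, a semistandard tableau of
content `(r, …, r)` with at most `d` columns.

*Multigraphs* (`gHat_eq`). The matrix of edge multiplicities is completed to a growth diagram by
the piecewise linear form `localRule` of the Robinson–Schensted–Knuth rule. This rule has the
explicit inverse `coLocalRule`, so a matrix amounts to the pair of boundaries of its growth diagram
(`growth_eq_of_boundary`, `exists_growth`). Sizes of shapes are sums of matrix entries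
(`sum_growth`), whence regularity becomes the condition that all strips have size `r`. On first
rows the rule reads `m + max (u 0) (v 0)`, which is the recursion for the largest planar subgraph
in the upper left blocks of the matrix (`planarSubgraphsAtMost_iff`), because an edge in the last
row and an edge in the last column, both different from the corner, cross.

*Tableaux* (`ncard_tableauPairs`). The block condition forces the entries of a block to occupy
different columns, from left to right (`YoungTableau.filling_eq`). A tableau is therefore determined
by the set of columns of each block, and every dominant sequence is numbered in this way by a
tableau (`seqTableau`).

*Walks* (`sum_sign_card_eq`, `ncard_blockIncreasingWalks`). A block of `r` strictly increasing
directions is a set of `r` columns, so the walks to `toeplitzPoint π` are the pairs of sequences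
`S, R`, without dominance, whose contents differ by that point. After a shift of the start point to
`(0, -1, …, 1 - d)` the signed sum is the sum of the alternating function `signedEndpoint` over all
these walks. A block changes a difference of two coordinates by at most one, so that a walk cannot
leave the dominant region without visiting a wall, where alternating functions vanish. Hence only
the walks inside the region count (`IsAlternating.sum_walks_eq`), and for these `π = 1`. The second
half of the walk, reversed, is the dominant sequence `R`.
-/

namespace PlanarSubgraph

open Finset

/-! ### Sequences of vertical strips, recorded by their columns -/

/-- The sequence `S` lists, for each of `n` blocks, the set of columns that receive a new cell.
`content S t k` is the height of column `k` after the first `t` blocks; it is `0` for `k ≥ d`. -/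
def content {n d : ℕ} (S : Fin n → Finset (Fin d)) (t k : ℕ) : ℕ :=
  #{i : Fin n | i.1 < t ∧ ∃ h : k < d, (⟨k, h⟩ : Fin d) ∈ S i}

/-- Each block has `r` columns, and after each block the column heights are those of a Young
diagram. Such sequences encode semistandard tableaux of content `(r, …, r)` with at most `d`
columns. -/
def IsDominant {n d : ℕ} (r : ℕ) (S : Fin n → Finset (Fin d)) : Prop :=
  (∀ i, #(S i) = r) ∧ ∀ t, Antitone (content S t)

/-- Pairs of dominant sequences with the same final column heights. -/
def dominantPairs (r n d : ℕ) : Set ((Fin n → Finset (Fin d)) × (Fin n → Finset (Fin d))) :=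
  {p | IsDominant r p.1 ∧ IsDominant r p.2 ∧ content p.1 n = content p.2 n}

variable {n d : ℕ}

theorem content_zero (S : Fin n → Finset (Fin d)) : content S 0 = 0 := by
  ext k; simp [content]

theorem content_of_le (S : Fin n → Finset (Fin d)) (t : ℕ) {k : ℕ} (hk : d ≤ k) :
    content S t k = 0 := by
  simp [content, not_lt.2 hk]

theorem content_succ (S : Fin n → Finset (Fin d)) (i : Fin n) (k : Fin d) :
    content S (i + 1) k = content S i k + if k ∈ S i then 1 else 0 := by
  have h (j : Fin n) : (j.1 < i.1 + 1 ∧ ∃ h : k.1 < d, (⟨k.1, h⟩ : Fin d) ∈ S j) ↔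
      (j.1 < i.1 ∧ ∃ h : k.1 < d, (⟨k.1, h⟩ : Fin d) ∈ S j) ∨ (j = i ∧ k ∈ S i) := by
    have hk : (∃ h : k.1 < d, (⟨k.1, h⟩ : Fin d) ∈ S j) ↔ k ∈ S j := by simp
    rw [hk, Nat.lt_succ_iff_lt_or_eq, Fin.val_inj]
    grind
  simp only [content, h]
  rw [filter_or, card_union_of_disjoint]
  · by_cases hk : k ∈ S i <;> simp [hk, filter_eq']
  · refine disjoint_filter.2 fun j _ hj h' => ?_
    rw [h'.1] at hj
    exact absurd hj.1 (lt_irrefl _)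

theorem content_le (S : Fin n → Finset (Fin d)) (t k : ℕ) : content S t k ≤ n :=
  (card_filter_le _ _).trans (by simp)

theorem content_mono (S : Fin n → Finset (Fin d)) (k : ℕ) : Monotone fun t => content S t k := by
  intro s t hst
  refine card_le_card fun i hi => ?_
  simp only [mem_filter, mem_univ, true_and] at hi ⊢
  exact ⟨hi.1.trans_le hst, hi.2⟩

theorem content_eq_of_le (S : Fin n → Finset (Fin d)) {t : ℕ} (ht : n ≤ t) :
    content S t = content S n := by
  ext k
  simp only [content]
  congr 1
  ext i
  simp [i.2.trans_le ht]

theorem content_succ_le (S : Fin n → Finset (Fin d)) (t k : ℕ) :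
    content S (t + 1) k ≤ content S t k + 1 := by
  by_cases hk : k < d
  · by_cases ht : t < n
    · have := content_succ S ⟨t, ht⟩ ⟨k, hk⟩
      simp only at this
      split_ifs at this <;> omega
    · rw [content_eq_of_le S (by omega : n ≤ t + 1), content_eq_of_le S (by omega : n ≤ t)]
      omega
  · simp [content_of_le S _ (not_lt.1 hk)]

theorem sum_content_succ (S : Fin n → Finset (Fin d)) (i : Fin n) :
    ∑ k : Fin d, content S (i + 1) k = ∑ k : Fin d, content S i k + #(S i) := by
  simp only [content_succ, sum_add_distrib]
  simp

theorem sum_content {S : Fin n → Finset (Fin d)} {r : ℕ} (h : ∀ i, #(S i) = r) {t : ℕ}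
    (ht : t ≤ n) : ∑ k : Fin d, content S t k = r * t := by
  induction t with
  | zero => simp [content_zero]
  | succ t ih => rw [sum_content_succ S ⟨t, ht⟩, h, ih (by omega)]; rfl

/-- The columns whose height grows in each of the first `n` steps of the sequence `x` of column
heights. -/
def growingColumns (n d : ℕ) (x : ℕ → ℕ → ℕ) (i : Fin n) : Finset (Fin d) :=
  {k | x i k < x (i + 1) k}

theorem growingColumns_content (S : Fin n → Finset (Fin d)) :
    growingColumns n d (content S) = S := by
  ext i k
  simp only [growingColumns, mem_filter, mem_univ, true_and, content_succ]
  split_ifs with h <;> simp [h]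

theorem growingColumns_congr {x y : ℕ → ℕ → ℕ} (h : ∀ t ≤ n, ∀ k < d, x t k = y t k) :
    growingColumns n d x = growingColumns n d y := by
  ext i k
  simp [growingColumns, h i i.2.le k k.2, h (i + 1) i.2 k k.2]

/-- A sequence of column heights in which each height grows by at most one at each step. -/
structure IsStripSeq (n d : ℕ) (x : ℕ → ℕ → ℕ) : Prop where
  zero : ∀ k, x 0 k = 0
  le_succ : ∀ t < n, ∀ k, x t k ≤ x (t + 1) k
  succ_le : ∀ t < n, ∀ k, x (t + 1) k ≤ x t k + 1
  eq_zero : ∀ t ≤ n, ∀ k, d ≤ k → x t k = 0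

namespace IsStripSeq

variable {x : ℕ → ℕ → ℕ}

theorem content_growingColumns (hx : IsStripSeq n d x) {t : ℕ} (ht : t ≤ n) :
    content (growingColumns n d x) t = x t := by
  ext k
  by_cases hk : k < d
  · induction t with
    | zero => rw [content_zero, hx.zero]; rfl
    | succ t ih =>
      have h1 := content_succ (growingColumns n d x) ⟨t, ht⟩ ⟨k, hk⟩
      have h2 := hx.le_succ t ht k
      have h3 := hx.succ_le t ht k
      simp only [growingColumns, mem_filter, mem_univ, true_and] at h1
      rw [ih (by omega)] at h1
      split_ifs at h1 <;> omega
  · rw [content_of_le _ _ (not_lt.1 hk), hx.eq_zero t ht k (not_lt.1 hk)]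

theorem isDominant (hx : IsStripSeq n d x) {r : ℕ} (hanti : ∀ t ≤ n, Antitone (x t))
    (hsum : ∀ t ≤ n, ∑ k : Fin d, x t k = r * t) : IsDominant r (growingColumns n d x) := by
  refine ⟨fun i => ?_, fun t => ?_⟩
  · have h := sum_content_succ (growingColumns n d x) i
    rw [hx.content_growingColumns i.2.le, hx.content_growingColumns (t := i.1 + 1) i.2,
      hsum _ i.2.le, hsum _ i.2, Nat.mul_succ] at h
    omega
  · rcases le_total t n with ht | ht
    · rw [hx.content_growingColumns ht]; exact hanti t ht
    · rw [content_eq_of_le _ ht, hx.content_growingColumns le_rfl]; exact hanti n le_rfl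

end IsStripSeq

/-! ### Conjugate partitions -/

theorem lt_card_filter_range_iff {K : ℕ} {p : ℕ → Prop} [DecidablePred p]
    (hp : ∀ i j, i ≤ j → j < K → p j → p i) {i : ℕ} :
    i < #{i ∈ range K | p i} ↔ i < K ∧ p i := by
  constructor
  · intro h
    by_contra hc
    have : ({i ∈ range K | p i} : Finset ℕ) ⊆ range i := by
      intro j hj
      simp only [mem_filter, mem_range] at hj ⊢
      by_contra hij
      exact hc ⟨by omega, hp i j (by omega) hj.1 hj.2⟩
    have := card_le_card this
    rw [card_range] at this
    exact absurd h (not_lt.2 this)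
  · rintro ⟨hi, hk⟩
    have : range (i + 1) ⊆ ({i ∈ range K | p i} : Finset ℕ) := by
      intro j hj
      simp only [mem_filter, mem_range] at hj ⊢
      exact ⟨by omega, hp j i (by omega) hi hk⟩
    simpa [Nat.succ_le_iff] using card_le_card this

/-- The conjugate of the partition `f`: the number of `i < K` with `k < f i`, where `f` is supposed
to vanish from `K` on. -/
def conj (K : ℕ) (f : ℕ → ℕ) (k : ℕ) : ℕ := #{i ∈ range K | k < f i}

theorem lt_conj_iff {K : ℕ} {f : ℕ → ℕ} (hf : Antitone f) {i k : ℕ} :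
    i < conj K f k ↔ i < K ∧ k < f i :=
  lt_card_filter_range_iff fun _ _ hij _ h => h.trans_le (hf hij)

theorem conj_antitone (K : ℕ) (f : ℕ → ℕ) : Antitone (conj K f) := by
  intro k l hkl
  refine card_le_card fun i hi => ?_
  simp only [mem_filter] at hi ⊢
  exact ⟨hi.1, hkl.trans_lt hi.2⟩

theorem conj_eq_zero {K : ℕ} {f : ℕ → ℕ} {k : ℕ} (h : ∀ i, f i ≤ k) : conj K f k = 0 := by
  simp [conj, not_lt.2 (h _)]

theorem conj_conj {K L : ℕ} {f : ℕ → ℕ} (hf : Antitone f) (hK : ∀ i, K ≤ i → f i = 0)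
    (hL : f 0 ≤ L) : conj L (conj K f) = f := by
  ext i
  refine eq_of_forall_lt_iff fun m => ?_
  rw [lt_conj_iff (conj_antitone K f), lt_conj_iff hf]
  constructor
  · exact fun h => h.2.2
  · intro h
    refine ⟨h.trans_le ((hf (Nat.zero_le i)).trans hL), ?_, h⟩
    by_contra hi
    rw [hK i (not_lt.1 hi)] at h
    omega

theorem sum_conj {K L : ℕ} {f : ℕ → ℕ} (hL : ∀ i, f i ≤ L) :
    ∑ k : Fin L, conj K f k = ∑ i ∈ range K, f i := by
  rw [← sum_range (conj K f)]
  have := sum_card_bipartiteAbove_eq_sum_card_bipartiteBelow (s := range L) (t := range K)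
    (fun k i => k < f i)
  refine this.trans (sum_congr rfl fun i _ => ?_)
  have : (range L).bipartiteBelow (fun k i => k < f i) i = range (f i) := by
    ext k
    simp only [mem_bipartiteBelow, mem_range]
    exact ⟨fun h => h.2, fun h => ⟨h.trans_le (hL i), h⟩⟩
  rw [this, card_range]

/-! ### The local rule of the Robinson–Schensted–Knuth correspondence -/

/-- The partitions `a ⊆ b`, given by their row lengths, differ by a horizontal strip. -/
def Interlaces (a b : ℕ → ℕ) : Prop := ∀ k, a k ≤ b k ∧ b (k + 1) ≤ a k

theorem Interlaces.antitone_right {a b : ℕ → ℕ} (h : Interlaces a b) : Antitone b :=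
  antitone_nat_of_succ_le fun k => (h k).2.trans (h k).1

theorem Interlaces.antitone_left {a b : ℕ → ℕ} (h : Interlaces a b) : Antitone a :=
  antitone_nat_of_succ_le fun k => (h (k + 1)).1.trans (h k).2

theorem interlaces_self_of_antitone {a : ℕ → ℕ} (h : Antitone a) : Interlaces a a :=
  fun k => ⟨le_rfl, h k.le_succ⟩

/-- The piecewise linear rule that completes a square of partitions with corners `l`, `u`, `v` and
matrix entry `m`. -/
def localRule (m : ℕ) (l u v : ℕ → ℕ) : ℕ → ℕ
  | 0 => m + max (u 0) (v 0)
  | k + 1 => max (u (k + 1)) (v (k + 1)) + min (u k) (v k) - l k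

/-- The inverse of `localRule`: the corner `l` from the three others. -/
def coLocalRule (w u v : ℕ → ℕ) (k : ℕ) : ℕ :=
  max (u (k + 1)) (v (k + 1)) + min (u k) (v k) - w (k + 1)

section LocalRule

variable {m : ℕ} {l u v w : ℕ → ℕ}

theorem localRule_comm (m : ℕ) (l u v : ℕ → ℕ) : localRule m l u v = localRule m l v u := by
  ext k; cases k <;> simp [localRule, max_comm, min_comm]

theorem coLocalRule_comm (w u v : ℕ → ℕ) : coLocalRule w u v = coLocalRule w v u := by
  ext k; simp [coLocalRule, max_comm, min_comm]

theorem interlaces_localRule (hu : Interlaces l u) (hv : Interlaces l v) :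
    Interlaces u (localRule m l u v) := by
  intro k
  have h1 := hu k
  have h2 := hv k
  refine ⟨?_, by simp only [localRule]; omega⟩
  cases k with
  | zero => simp only [localRule]; omega
  | succ k =>
    have h3 := hu k
    have h4 := hv k
    simp only [localRule]; omega

theorem coLocalRule_interlaces (hu : Interlaces u w) (hv : Interlaces v w) :
    Interlaces (coLocalRule w u v) u := by
  intro k
  have h1 := hu k
  have h2 := hv k
  have h3 := hu (k + 1)
  have h4 := hv (k + 1)
  simp only [coLocalRule]; omega

theorem coLocalRule_localRule (hu : Interlaces l u) (hv : Interlaces l v) :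
    coLocalRule (localRule m l u v) u v = l := by
  ext k
  have h1 := hu k
  have h2 := hv k
  simp only [coLocalRule, localRule]; omega

theorem localRule_coLocalRule (hu : Interlaces u w) (hv : Interlaces v w) :
    localRule (w 0 - max (u 0) (v 0)) (coLocalRule w u v) u v = w := by
  ext k
  cases k with
  | zero =>
    have h1 := hu 0
    have h2 := hv 0
    simp only [localRule]; omega
  | succ k =>
    have h1 := hu k
    have h2 := hv k
    have h3 := hu (k + 1)
    have h4 := hv (k + 1)
    simp only [localRule, coLocalRule]; omega

/-- The local rule preserves sizes because `max a b + min a b = a + b`. -/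
theorem sum_localRule (hu : Interlaces l u) (hv : Interlaces l v) (K : ℕ) :
    ∑ k ∈ range (K + 1), localRule m l u v k + ∑ k ∈ range K, l k =
      m + ∑ k ∈ range K, u k + ∑ k ∈ range K, v k + max (u K) (v K) := by
  induction K with
  | zero => simp [localRule]
  | succ K ih =>
    rw [sum_range_succ _ (K + 1), sum_range_succ l, sum_range_succ u, sum_range_succ v]
    have h1 := hu K
    have h2 := hv K
    simp only [localRule] at ih ⊢
    omega

end LocalRule

/-! ### Growth diagrams -/

/-- The growth diagram of the matrix `A`: `growth A i j` is the shape, given by its row lengths,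
of the insertion tableau of the upper left `i × j` block. -/
def growth (A : ℕ → ℕ → ℕ) : ℕ → ℕ → ℕ → ℕ
  | 0, _ => 0
  | _ + 1, 0 => 0
  | i + 1, j + 1 => localRule (A i j) (growth A i j) (growth A i (j + 1)) (growth A (i + 1) j)
termination_by i j => i + j

section Growth

variable (A : ℕ → ℕ → ℕ)

@[simp] theorem growth_zero_left (j : ℕ) : growth A 0 j = 0 := by rw [growth]

@[simp] theorem growth_zero_right (i : ℕ) : growth A i 0 = 0 := by cases i <;> rw [growth]

theorem growth_succ_succ (i j : ℕ) : growth A (i + 1) (j + 1) =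
    localRule (A i j) (growth A i j) (growth A i (j + 1)) (growth A (i + 1) j) := by
  rw [growth]

theorem interlaces_growth (i : ℕ) : ∀ j, Interlaces (growth A i j) (growth A i (j + 1)) ∧
    Interlaces (growth A i j) (growth A (i + 1) j) := by
  have key (i : ℕ) (h : ∀ j, Interlaces (growth A i j) (growth A i (j + 1))) (j : ℕ) :
      Interlaces (growth A i j) (growth A (i + 1) j) := by
    induction j with
    | zero => simp [Interlaces]
    | succ j ih => rw [growth_succ_succ]; exact interlaces_localRule (h j) ih
  have h : ∀ j, Interlaces (growth A i j) (growth A i (j + 1)) := by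
    induction i with
    | zero => simp [Interlaces]
    | succ i ih =>
      intro j
      rw [growth_succ_succ, localRule_comm]
      exact interlaces_localRule (key i ih j) (ih j)
  exact fun j => ⟨h j, key i h j⟩

theorem growth_interlaces_right (i j : ℕ) : Interlaces (growth A i j) (growth A i (j + 1)) :=
  (interlaces_growth A i j).1

theorem growth_interlaces_left (i j : ℕ) : Interlaces (growth A i j) (growth A (i + 1) j) :=
  (interlaces_growth A i j).2

theorem growth_antitone (i j : ℕ) : Antitone (growth A i j) :=
  (growth_interlaces_right A i j).antitone_left

theorem growth_eq_zero {i k : ℕ} (h : i ≤ k) (j : ℕ) : growth A i j k = 0 := by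
  induction i generalizing k with
  | zero => simp
  | succ i ih =>
    obtain ⟨k, rfl⟩ : ∃ k', k = k' + 1 := ⟨k - 1, by omega⟩
    have := (growth_interlaces_left A i j k).2
    rw [ih (by omega)] at this
    omega

theorem sum_growth {i K : ℕ} (h : i ≤ K) (j : ℕ) :
    ∑ k ∈ range K, growth A i j k = ∑ i' ∈ range i, ∑ j' ∈ range j, A i' j' := by
  induction i generalizing j with
  | zero => simp
  | succ i ih =>
    induction j with
    | zero => simp
    | succ j ihj =>
      have hs := sum_localRule (m := A i j) (growth_interlaces_right A i j)
        (growth_interlaces_left A i j) K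
      have h1 := ih (by omega) j
      have h2 := ih (by omega) (j + 1)
      rw [← growth_succ_succ, sum_range_succ _ K, growth_eq_zero A h,
        growth_eq_zero A (by omega : i ≤ K), growth_eq_zero A h] at hs
      rw [sum_range_succ] at ihj ⊢
      rw [sum_range_succ _ j]
      simp only [max_self, add_zero] at hs
      omega

theorem growth_mono_left {i i' : ℕ} (h : i ≤ i') (j k : ℕ) : growth A i j k ≤ growth A i' j k :=
  monotone_nat_of_le_succ (f := fun i => growth A i j k)
    (fun i => (growth_interlaces_left A i j k).1) h

theorem growth_mono_right (i : ℕ) {j j' : ℕ} (h : j ≤ j') (k : ℕ) :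
    growth A i j k ≤ growth A i j' k :=
  monotone_nat_of_le_succ (f := fun j => growth A i j k)
    (fun j => (growth_interlaces_right A i j k).1) h

theorem coLocalRule_growth (i j : ℕ) : coLocalRule (growth A (i + 1) (j + 1))
    (growth A i (j + 1)) (growth A (i + 1) j) = growth A i j := by
  rw [growth_succ_succ]
  exact coLocalRule_localRule (growth_interlaces_right A i j) (growth_interlaces_left A i j)

theorem matrix_eq_growth (i j : ℕ) : A i j = growth A (i + 1) (j + 1) 0 -
    max (growth A i (j + 1) 0) (growth A (i + 1) j 0) := by
  rw [growth_succ_succ, localRule]; omega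

/-- A growth diagram is determined by its lower and right boundaries. -/
theorem growth_eq_of_boundary {A B : ℕ → ℕ → ℕ} {n : ℕ}
    (hrow : ∀ t ≤ n, growth A n t = growth B n t) (hcol : ∀ t ≤ n, growth A t n = growth B t n)
    {i j : ℕ} (hi : i ≤ n) (hj : j ≤ n) : growth A i j = growth B i j := by
  induction hi using Nat.decreasingInduction generalizing j with
  | self => exact hrow j hj
  | of_succ i hi ih =>
    induction hj using Nat.decreasingInduction with
    | self => exact hcol i hi.le
    | of_succ j hj ihj =>
      rw [← coLocalRule_growth A, ← coLocalRule_growth B, ihj, ih hj, ih hj.le]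

/-- The growth diagram rebuilt from its lower boundary `u` and its right boundary `v`. The indices
`p` and `q` are the distances to these boundaries. -/
def coGrowth (u v : ℕ → ℕ → ℕ) : ℕ → ℕ → ℕ → ℕ
  | 0, q => u q
  | p + 1, 0 => v (p + 1)
  | p + 1, q + 1 =>
    coLocalRule (coGrowth u v p q) (coGrowth u v p (q + 1)) (coGrowth u v (p + 1) q)
termination_by p q => p + q

section CoGrowth

variable {u v : ℕ → ℕ → ℕ}

theorem coGrowth_zero_left (q : ℕ) : coGrowth u v 0 q = u q := by rw [coGrowth]

theorem coGrowth_zero_right (h : u 0 = v 0) (p : ℕ) : coGrowth u v p 0 = v p := by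
  cases p <;> rw [coGrowth]; exact h

theorem coGrowth_succ_succ (p q : ℕ) : coGrowth u v (p + 1) (q + 1) =
    coLocalRule (coGrowth u v p q) (coGrowth u v p (q + 1)) (coGrowth u v (p + 1) q) := by
  rw [coGrowth]

theorem interlaces_coGrowth (h : u 0 = v 0) (hu : ∀ q, Interlaces (u (q + 1)) (u q))
    (hv : ∀ p, Interlaces (v (p + 1)) (v p)) (p : ℕ) :
    ∀ q, Interlaces (coGrowth u v p (q + 1)) (coGrowth u v p q) ∧
      Interlaces (coGrowth u v (p + 1) q) (coGrowth u v p q) := by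
  have key (p : ℕ) (hp : ∀ q, Interlaces (coGrowth u v p (q + 1)) (coGrowth u v p q)) (q : ℕ) :
      Interlaces (coGrowth u v (p + 1) q) (coGrowth u v p q) := by
    induction q with
    | zero => rw [coGrowth_zero_right h, coGrowth_zero_right h]; exact hv p
    | succ q ih =>
      rw [coGrowth_succ_succ]
      exact coLocalRule_interlaces (hp q) ih
  have hp : ∀ q, Interlaces (coGrowth u v p (q + 1)) (coGrowth u v p q) := by
    induction p with
    | zero => intro q; rw [coGrowth_zero_left, coGrowth_zero_left]; exact hu q
    | succ p ih =>
      intro q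
      rw [coGrowth_succ_succ, coLocalRule_comm]
      exact coLocalRule_interlaces (key p ih q) (ih q)
  exact fun q => ⟨hp q, key p hp q⟩

end CoGrowth

/-- Every pair of boundaries that satisfy the interlacing conditions belongs to a growth diagram. -/
theorem exists_growth {n : ℕ} {x y : ℕ → ℕ → ℕ} (hx0 : x 0 = 0) (hy0 : y 0 = 0)
    (hxy : x n = y n) (hx : ∀ t, Interlaces (x t) (x (t + 1)))
    (hy : ∀ t, Interlaces (y t) (y (t + 1))) :
    ∃ A : ℕ → ℕ → ℕ, (∀ t ≤ n, growth A n t = x t) ∧ ∀ t ≤ n, growth A t n = y t := by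
  set u : ℕ → ℕ → ℕ := fun q => x (n - q) with hu
  set v : ℕ → ℕ → ℕ := fun p => y (n - p) with hv
  have huv : u 0 = v 0 := by simp [hu, hv, hxy]
  have reverse {z : ℕ → ℕ → ℕ} (hz : ∀ t, Interlaces (z t) (z (t + 1))) (q : ℕ) :
      Interlaces (z (n - (q + 1))) (z (n - q)) := by
    rcases lt_or_ge q n with h | h
    · have := hz (n - (q + 1))
      rwa [show n - (q + 1) + 1 = n - q by omega] at this
    · rw [show n - (q + 1) = n - q by omega]
      exact interlaces_self_of_antitone (hz _).antitone_left
  have hint := interlaces_coGrowth huv (reverse hx) (reverse hy)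
  set B := coGrowth u v with hB
  have hB1 (q k : ℕ) : B n q k = 0 := by
    have h1 : B n q k ≤ B n 0 k :=
      antitone_nat_of_succ_le (f := fun q => B n q k) (fun q => ((hint n q).1 k).1) (Nat.zero_le q)
    rw [hB, coGrowth_zero_right huv] at h1
    simpa [hv, hy0] using h1
  have hB2 (p k : ℕ) : B p n k = 0 := by
    have h1 : B p n k ≤ B 0 n k :=
      antitone_nat_of_succ_le (f := fun p => B p n k) (fun p => ((hint p n).2 k).1) (Nat.zero_le p)
    rw [hB, coGrowth_zero_left] at h1
    simpa [hu, hx0] using h1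
  let A : ℕ → ℕ → ℕ := fun i j => B (n - (i + 1)) (n - (j + 1)) 0 -
    max (B (n - i) (n - (j + 1)) 0) (B (n - (i + 1)) (n - j) 0)
  have hA : ∀ i ≤ n, ∀ j ≤ n, growth A i j = B (n - i) (n - j) := by
    intro i hi
    induction i with
    | zero => intro j _; ext k; simp [hB1]
    | succ i ih =>
      intro j hj
      induction j with
      | zero => ext k; simp [hB2]
      | succ j ihj =>
        rw [growth_succ_succ, ih (by omega) j (by omega), ih (by omega) (j + 1) hj,
          ihj (by omega)]
        obtain ⟨p, hp⟩ : ∃ p, n - i = p + 1 := ⟨n - (i + 1), by omega⟩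
        obtain ⟨q, hq⟩ : ∃ q, n - j = q + 1 := ⟨n - (j + 1), by omega⟩
        have hp' : n - (i + 1) = p := by omega
        have hq' : n - (j + 1) = q := by omega
        simp only [A, hp, hq, hp', hq']
        rw [hB, coGrowth_succ_succ, coLocalRule_comm]
        exact localRule_coLocalRule (hint p q).2 (hint p q).1
  refine ⟨A, fun t ht => ?_, fun t ht => ?_⟩
  · rw [hA n le_rfl t ht, Nat.sub_self, hB, coGrowth_zero_left]
    simp [hu, Nat.sub_sub_self ht]
  · rw [hA t ht n le_rfl, Nat.sub_self, hB, coGrowth_zero_right huv]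
    simp [hv, Nat.sub_sub_self ht]

end Growth

/-! ### Multigraphs as matrices, and their largest planar subgraphs -/

section EdgeMatrix

variable {n : ℕ}

/-- The matrix of edge multiplicities of `G`, continued by `0`. -/
def edgeMatrix (G : BipartiteMultigraph (Fin n) (Fin n)) (i j : ℕ) : ℕ :=
  if h : i < n ∧ j < n then G.count (⟨i, h.1⟩, ⟨j, h.2⟩) else 0

theorem edgeMatrix_val (G : BipartiteMultigraph (Fin n) (Fin n)) (i j : Fin n) :
    edgeMatrix G i j = G.count (i, j) := by
  simp [edgeMatrix]

theorem eq_of_edgeMatrix_eq {G H : BipartiteMultigraph (Fin n) (Fin n)}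
    (h : ∀ i < n, ∀ j < n, edgeMatrix G i j = edgeMatrix H i j) : G = H := by
  ext ⟨i, j⟩
  rw [← edgeMatrix_val, ← edgeMatrix_val, h i i.2 j j.2]

theorem exists_edgeMatrix_eq (A : ℕ → ℕ → ℕ) : ∃ G : BipartiteMultigraph (Fin n) (Fin n),
    ∀ i < n, ∀ j < n, edgeMatrix G i j = A i j := by
  refine ⟨Finsupp.toMultiset (Finsupp.equivFunOnFinite.symm fun e : Fin n × Fin n => A e.1 e.2),
    fun i hi j hj => ?_⟩
  simp [edgeMatrix, hi, hj, Finsupp.count_toMultiset]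

theorem card_filter_fst (G : BipartiteMultigraph (Fin n) (Fin n)) (u : Fin n) :
    (G.filter fun e => e.1 = u).card = ∑ j ∈ range n, edgeMatrix G u j := by
  rw [sum_range]
  simp only [edgeMatrix_val]
  rw [← Multiset.sum_count_eq_card (s := univ) (by simp), Fintype.sum_prod_type,
    Fintype.sum_eq_single u]
  · exact sum_congr rfl fun j _ => by simp
  · intro v hv
    exact sum_eq_zero fun j _ => by simp [hv]

theorem card_filter_snd (G : BipartiteMultigraph (Fin n) (Fin n)) (v : Fin n) :
    (G.filter fun e => e.2 = v).card = ∑ i ∈ range n, edgeMatrix G i v := by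
  rw [sum_range]
  simp only [edgeMatrix_val]
  rw [← Multiset.sum_count_eq_card (s := univ) (by simp), Fintype.sum_prod_type_right,
    Fintype.sum_eq_single v]
  · exact sum_congr rfl fun j _ => by simp
  · intro u hu
    exact sum_eq_zero fun j _ => by simp [hu]

theorem isRegular_iff {r : ℕ} {G : BipartiteMultigraph (Fin n) (Fin n)} : IsRegular r G ↔
    (∀ i < n, ∑ j ∈ range n, edgeMatrix G i j = r) ∧
      ∀ j < n, ∑ i ∈ range n, edgeMatrix G i j = r := by
  simp only [IsRegular, card_filter_fst, card_filter_snd]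
  exact and_congr ⟨fun h i hi => h ⟨i, hi⟩, fun h i => h i i.2⟩
    ⟨fun h i hi => h ⟨i, hi⟩, fun h i => h i i.2⟩

/-- No planar subgraph in the upper left `i × j` block is larger than the first row of the shape at
`(i, j)`. -/
theorem card_le_growth (G : BipartiteMultigraph (Fin n) (Fin n)) (i j : ℕ)
    (S : BipartiteMultigraph (Fin n) (Fin n)) (hS : S ≤ G) (hp : IsPlanar S)
    (hbox : ∀ e ∈ S, e.1.1 < i ∧ e.2.1 < j) : S.card ≤ growth (edgeMatrix G) i j 0 := by
  have empty_case {i j : ℕ} (S : BipartiteMultigraph (Fin n) (Fin n))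
      (h : i = 0 ∨ j = 0) (hbox : ∀ e ∈ S, e.1.1 < i ∧ e.2.1 < j) : S.card = 0 := by
    rw [Multiset.card_eq_zero]
    refine Multiset.eq_zero_of_forall_notMem fun e he => ?_
    have := hbox e he
    omega
  induction i generalizing j S with
  | zero => simp [empty_case S (.inl rfl) hbox]
  | succ i ih =>
    induction j generalizing S with
    | zero => simp [empty_case S (.inr rfl) hbox]
    | succ j ihj =>
      rw [growth_succ_succ, localRule]
      by_cases hij : i < n ∧ j < n
      · set e₀ : Fin n × Fin n := (⟨i, hij.1⟩, ⟨j, hij.2⟩) with he₀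
        have hA : edgeMatrix G i j = G.count e₀ := by simp [edgeMatrix, hij, he₀]
        set T := S.filter fun e => ¬ e = e₀ with hT
        have hTS : T ≤ S := Multiset.filter_le _ _
        have hcard : S.card = S.count e₀ + T.card := by
          rw [Multiset.count_eq_card_filter_eq, ← Multiset.card_add]
          simp only [hT, eq_comm (a := e₀)]
          rw [Multiset.filter_add_not]
        have hcount : S.count e₀ ≤ edgeMatrix G i j := hA ▸ Multiset.count_le_of_le _ hS
        have hTp : IsPlanar T := fun e he f hf =>
          hp e (Multiset.mem_of_le hTS he) f (Multiset.mem_of_le hTS hf)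
        have hTbox (e) (he : e ∈ T) :
            e.1.1 < i + 1 ∧ e.2.1 < j + 1 ∧ ¬ (e.1.1 = i ∧ e.2.1 = j) := by
          have h := hbox e (Multiset.mem_of_le hTS he)
          refine ⟨h.1, h.2, fun h' => (Multiset.mem_filter.1 he).2 ?_⟩
          exact Prod.ext (Fin.ext h'.1) (Fin.ext h'.2)
        -- If `T` has an edge in the last row and one in the last column, these two cross.
        by_cases hrow : ∀ e ∈ T, e.1.1 < i
        · have := ih (j + 1) T (hTS.trans hS) hTp fun e he => ⟨hrow e he, (hTbox e he).2.1⟩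
          omega
        · push Not at hrow
          obtain ⟨e, he, hei⟩ := hrow
          have := ihj T (hTS.trans hS) hTp fun f hf => by
            refine ⟨(hTbox f hf).1, ?_⟩
            by_contra hfj
            refine hTp e he f hf (.inr ⟨?_, ?_⟩)
            · have := hTbox f hf
              have := hTbox e he
              rw [Fin.lt_def]; omega
            · have := hTbox f hf
              have := hTbox e he
              rw [Fin.lt_def]; omega
          omega
      · by_cases hi : i < n
        · have := ihj S hS hp fun e he => ⟨(hbox e he).1, by omega⟩
          omega
        · have := ih (j + 1) S hS hp fun e he => ⟨by omega, (hbox e he).2⟩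
          omega

/-- Some planar subgraph in the upper left `i × j` block is as large as the first row of the shape
at `(i, j)`: the copies of the edge in the corner cross no edge of the block. -/
theorem exists_card_eq_growth (G : BipartiteMultigraph (Fin n) (Fin n)) (i j : ℕ) :
    ∃ S ≤ G, IsPlanar S ∧ (∀ e ∈ S, e.1.1 < i ∧ e.2.1 < j) ∧
      S.card = growth (edgeMatrix G) i j 0 := by
  induction i generalizing j with
  | zero => exact ⟨0, by simp [IsPlanar]⟩
  | succ i ih =>
    induction j with
    | zero => exact ⟨0, by simp [IsPlanar]⟩
    | succ j ihj =>
      obtain ⟨S, hS, hp, hbox, hlast, hcard⟩ : ∃ S ≤ G, IsPlanar S ∧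
          (∀ e ∈ S, e.1.1 < i + 1 ∧ e.2.1 < j + 1) ∧ (∀ e ∈ S, ¬ (e.1.1 = i ∧ e.2.1 = j)) ∧
          S.card = max (growth (edgeMatrix G) i (j + 1) 0) (growth (edgeMatrix G) (i + 1) j 0) := by
        rcases le_total (growth (edgeMatrix G) (i + 1) j 0) (growth (edgeMatrix G) i (j + 1) 0)
          with h | h
        · obtain ⟨S, hS, hp, hbox, hcard⟩ := ih (j + 1)
          exact ⟨S, hS, hp, fun e he => by have := hbox e he; omega,
            fun e he => by have := hbox e he; omega, by rw [hcard, max_eq_left h]⟩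
        · obtain ⟨S, hS, hp, hbox, hcard⟩ := ihj
          exact ⟨S, hS, hp, fun e he => by have := hbox e he; omega,
            fun e he => by have := hbox e he; omega, by rw [hcard, max_eq_right h]⟩
      rw [growth_succ_succ, localRule]
      by_cases hij : i < n ∧ j < n
      · set e₀ : Fin n × Fin n := (⟨i, hij.1⟩, ⟨j, hij.2⟩) with he₀
        have hA : edgeMatrix G i j = G.count e₀ := by simp [edgeMatrix, hij, he₀]
        have hmem (e) (he : e ∈ Multiset.replicate (edgeMatrix G i j) e₀ + S) :
            e = e₀ ∨ e ∈ S := by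
          rw [Multiset.mem_add] at he
          exact he.imp Multiset.eq_of_mem_replicate id
        have hcross (e) (he : e.1.1 < i + 1 ∧ e.2.1 < j + 1) :
            ¬ Crossing e₀ e ∧ ¬ Crossing e e₀ := by
          simp only [Crossing, Fin.lt_def, he₀]; omega
        have he₀box : e₀.1.1 < i + 1 ∧ e₀.2.1 < j + 1 := by simp [he₀]
        refine ⟨Multiset.replicate (edgeMatrix G i j) e₀ + S, ?_, ?_, ?_, by simp [hcard]⟩
        · rw [Multiset.le_iff_count]
          intro e
          rw [Multiset.count_add, Multiset.count_replicate]
          split_ifs with h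
          · subst h
            rw [Multiset.count_eq_zero_of_notMem (fun h => hlast _ h (by simp [he₀])), hA]
            omega
          · simpa using Multiset.le_iff_count.1 hS e
        · intro e he f hf
          rcases hmem e he with rfl | he
          · rcases hmem f hf with rfl | hf
            · exact (hcross _ he₀box).1
            · exact (hcross f (hbox f hf)).1
          · rcases hmem f hf with rfl | hf
            · exact (hcross e (hbox e he)).2
            · exact hp e he f hf
        · intro e he
          rcases hmem e he with rfl | he
          · exact he₀box
          · exact hbox e he
      · exact ⟨S, hS, hp, hbox, by simp [edgeMatrix, hij, hcard]⟩

/-- The first row of the corner of the growth diagram is the size of a largest planar subgraph. -/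
theorem planarSubgraphsAtMost_iff {d : ℕ} {G : BipartiteMultigraph (Fin n) (Fin n)} :
    PlanarSubgraphsAtMost d G ↔ growth (edgeMatrix G) n n 0 ≤ d := by
  constructor
  · intro h
    obtain ⟨S, hS, hp, -, hcard⟩ := exists_card_eq_growth G n n
    exact hcard ▸ h S hS hp
  · intro h S hS hp
    exact (card_le_growth G n n S hS hp fun e _ => ⟨e.1.2, e.2.2⟩).trans h

end EdgeMatrix

/-! ### From multigraphs to pairs of dominant sequences -/

variable {n d : ℕ}

/-- In terms of columns, adding a horizontal strip raises each height by at most one. -/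
theorem isStripSeq_conj {ρ : ℕ → ℕ → ℕ} (h0 : ρ 0 = 0) (hi : ∀ t, Interlaces (ρ t) (ρ (t + 1)))
    (hd : ρ n 0 ≤ d) : IsStripSeq n d fun t => conj n (ρ t) where
  zero k := conj_eq_zero (by simp [h0])
  le_succ t _ k := by
    refine card_le_card fun i hi' => ?_
    simp only [mem_filter] at hi' ⊢
    exact ⟨hi'.1, hi'.2.trans_le (hi t i).1⟩
  succ_le t _ k := by
    by_contra! h
    have h1 := (lt_conj_iff (hi t).antitone_right).1 h
    have h2 := (hi t (conj n (ρ t) k)).2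
    have := (lt_conj_iff (K := n) (hi t).antitone_left (i := conj n (ρ t) k) (k := k)).2
      ⟨by omega, by omega⟩
    omega
  eq_zero t ht k hk := conj_eq_zero fun i => by
    have h1 : ρ t 0 ≤ ρ n 0 :=
      monotone_nat_of_le_succ (f := fun t => ρ t 0) (fun t => (hi t 0).1) ht
    have h2 := (hi t).antitone_left (Nat.zero_le i)
    omega

theorem interlaces_conj_content (S : Fin n → Finset (Fin d)) (t : ℕ) :
    Interlaces (conj d (content S t)) (conj d (content S (t + 1))) := by
  intro i
  have h1 (k : ℕ) : content S t k ≤ content S (t + 1) k := content_mono S k t.le_succ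
  have h2 := content_succ_le S t
  constructor <;> refine card_le_card fun k hk => ?_ <;> simp only [mem_filter] at hk ⊢
  · exact ⟨hk.1, hk.2.trans_le (h1 k)⟩
  · have := h2 k
    exact ⟨hk.1, by omega⟩

theorem growth_congr {A B : ℕ → ℕ → ℕ} (h : ∀ i < n, ∀ j < n, A i j = B i j) {i j : ℕ}
    (hi : i ≤ n) (hj : j ≤ n) : growth A i j = growth B i j := by
  induction i generalizing j with
  | zero => simp
  | succ i ih =>
    induction j with
    | zero => simp
    | succ j ihj =>
      rw [growth_succ_succ, growth_succ_succ, h i hi j hj, ih (by omega) (by omega),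
        ih (by omega) hj, ihj (by omega)]

/-- The columns of the strips along the lower and the right boundary of the growth diagram. -/
def strips (n d : ℕ) (A : ℕ → ℕ → ℕ) : (Fin n → Finset (Fin d)) × (Fin n → Finset (Fin d)) :=
  (growingColumns n d fun t => conj n (growth A n t),
    growingColumns n d fun t => conj n (growth A t n))

theorem sum_conj_growth {A : ℕ → ℕ → ℕ} (hd : growth A n n 0 ≤ d) {i j : ℕ} (hi : i ≤ n)
    (hj : j ≤ n) :
    ∑ k : Fin d, conj n (growth A i j) k = ∑ i' ∈ range i, ∑ j' ∈ range j, A i' j' := by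
  rw [← sum_growth A hi, sum_conj]
  intro k
  exact ((growth_antitone A i j k.zero_le).trans
    ((growth_mono_left A hi j 0).trans (growth_mono_right A n hj 0))).trans hd

theorem isStripSeq_lower {A : ℕ → ℕ → ℕ} (hd : growth A n n 0 ≤ d) :
    IsStripSeq n d fun t => conj n (growth A n t) :=
  isStripSeq_conj (growth_zero_right A n) (growth_interlaces_right A n) hd

theorem isStripSeq_right {A : ℕ → ℕ → ℕ} (hd : growth A n n 0 ≤ d) :
    IsStripSeq n d fun t => conj n (growth A t n) :=
  isStripSeq_conj (ρ := fun t => growth A t n) (growth_zero_left A n)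
    (fun t => growth_interlaces_left A t n) hd

/-- Regularity of the matrix says that all strips along the two boundaries have size `r`. -/
theorem strips_mem {A : ℕ → ℕ → ℕ} {r : ℕ} (hd : growth A n n 0 ≤ d)
    (hrow : ∀ i < n, ∑ j ∈ range n, A i j = r) (hcol : ∀ j < n, ∑ i ∈ range n, A i j = r) :
    strips n d A ∈ dominantPairs r n d := by
  refine ⟨(isStripSeq_lower hd).isDominant (fun t _ => conj_antitone _ _) fun t ht => ?_,
    (isStripSeq_right hd).isDominant (fun t _ => conj_antitone _ _) fun t ht => ?_, ?_⟩
  · rw [sum_conj_growth hd le_rfl ht, sum_comm,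
      sum_congr rfl fun j hj => hcol j ((mem_range.1 hj).trans_le ht)]
    simp [mul_comm]
  · rw [sum_conj_growth hd ht le_rfl,
      sum_congr rfl fun j hj => hrow j ((mem_range.1 hj).trans_le ht)]
    simp [mul_comm]
  · simp only [strips]
    rw [(isStripSeq_lower hd).content_growingColumns le_rfl,
      (isStripSeq_right hd).content_growingColumns le_rfl]

theorem growth_eq_of_strips_eq {A B : ℕ → ℕ → ℕ} (hA : growth A n n 0 ≤ d)
    (hB : growth B n n 0 ≤ d) (h : strips n d A = strips n d B) {i j : ℕ} (hi : i ≤ n)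
    (hj : j ≤ n) : growth A i j = growth B i j := by
  simp only [strips, Prod.mk.injEq] at h
  have bound (A : ℕ → ℕ → ℕ) (hA : growth A n n 0 ≤ d) {i j : ℕ} (hi : i ≤ n) (hj : j ≤ n) :
      conj d (conj n (growth A i j)) = growth A i j :=
    conj_conj (growth_antitone A i j) (fun k hk => growth_eq_zero A (hi.trans hk) j)
      (((growth_mono_left A hi j 0).trans (growth_mono_right A n hj 0)).trans hA)
  refine growth_eq_of_boundary (fun t ht => ?_) (fun t ht => ?_) hi hj
  · rw [← bound A hA le_rfl ht, ← bound B hB le_rfl ht,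
      ← (isStripSeq_lower hA).content_growingColumns ht,
      ← (isStripSeq_lower hB).content_growingColumns ht, h.1]
  · rw [← bound A hA ht le_rfl, ← bound B hB ht le_rfl,
      ← (isStripSeq_right hA).content_growingColumns ht,
      ← (isStripSeq_right hB).content_growingColumns ht, h.2]

theorem exists_strips_eq {r : ℕ} {p : (Fin n → Finset (Fin d)) × (Fin n → Finset (Fin d))}
    (hp : p ∈ dominantPairs r n d) : ∃ A : ℕ → ℕ → ℕ, strips n d A = p ∧ growth A n n 0 ≤ d ∧
      (∀ i < n, ∑ j ∈ range n, A i j = r) ∧ ∀ j < n, ∑ i ∈ range n, A i j = r := by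
  obtain ⟨hS, hR, hSR⟩ := hp
  have zero (S : Fin n → Finset (Fin d)) : conj d (content S 0) = 0 := by
    ext k; exact conj_eq_zero (by simp [content_zero])
  obtain ⟨A, hx, hy⟩ := exists_growth (n := n) (x := fun t => conj d (content p.1 t))
    (y := fun t => conj d (content p.2 t)) (zero _) (zero _) (by rw [hSR])
    (interlaces_conj_content _) (interlaces_conj_content _)
  have back {S : Fin n → Finset (Fin d)} (hS : IsDominant r S) (t : ℕ) :
      conj n (conj d (content S t)) = content S t :=
    conj_conj (hS.2 t) (fun k => content_of_le S t) (content_le S t 0)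
  have hd : growth A n n 0 ≤ d := by
    rw [hx n le_rfl]
    exact (card_filter_le _ _).trans (by simp)
  have hsum {S : Fin n → Finset (Fin d)} (hS : IsDominant r S) {t : ℕ} (ht : t ≤ n) :
      ∑ k ∈ range n, conj d (content S t) k = r * t := by
    rw [sum_range, sum_conj (content_le S t), sum_range, sum_content hS.1 ht]
  refine ⟨A, Prod.ext ?_ ?_, hd, fun i hi => ?_, fun j hj => ?_⟩
  · simp only [strips]
    rw [← growingColumns_content p.1]
    exact growingColumns_congr fun t ht k _ => by
      rw [hx t ht, back hS]
  · simp only [strips]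
    rw [← growingColumns_content p.2]
    exact growingColumns_congr fun t ht k _ => by
      rw [hy t ht, back hR]
  · have h1 := sum_growth A hi.le n
    have h2 := sum_growth A hi n
    rw [hy i hi.le, hsum hR hi.le] at h1
    rw [Nat.succ_eq_add_one, hy (i + 1) hi, hsum hR hi, sum_range_succ, ← h1, Nat.mul_succ] at h2
    omega
  · have h1 := sum_growth A le_rfl (i := n) j
    have h2 := sum_growth A le_rfl (i := n) (j + 1)
    rw [hx j hj.le, hsum hS hj.le, sum_comm] at h1
    rw [hx (j + 1) hj, hsum hS hj, sum_comm, sum_range_succ, ← h1, Nat.mul_succ] at h2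
    omega

theorem gHat_eq (r n d : ℕ) : gHat r n d = (dominantPairs r n d).ncard := by
  refine Set.BijOn.ncard_eq (f := fun G => strips n d (edgeMatrix G)) ⟨?_, ?_, ?_⟩
  · rintro G ⟨hreg, hd⟩
    rw [isRegular_iff] at hreg
    exact strips_mem (planarSubgraphsAtMost_iff.1 hd) hreg.1 hreg.2
  · rintro G ⟨-, hG⟩ H ⟨-, hH⟩ h
    have hgr {i j : ℕ} (hi : i ≤ n) (hj : j ≤ n) :=
      growth_eq_of_strips_eq (planarSubgraphsAtMost_iff.1 hG) (planarSubgraphsAtMost_iff.1 hH) h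
        hi hj
    refine eq_of_edgeMatrix_eq fun i hi j hj => ?_
    rw [matrix_eq_growth (edgeMatrix G), matrix_eq_growth (edgeMatrix H), hgr hi hj,
      hgr hi.le hj, hgr hi hj.le]
  · intro p hp
    obtain ⟨A, rfl, hd, hrow, hcol⟩ := exists_strips_eq hp
    obtain ⟨G, hG⟩ := exists_edgeMatrix_eq (n := n) A
    refine ⟨G, ⟨isRegular_iff.2 ⟨fun i hi => ?_, fun j hj => ?_⟩,
      planarSubgraphsAtMost_iff.2 ?_⟩, ?_⟩
    · rw [← hrow i hi]
      exact sum_congr rfl fun j hj => hG i hi j (mem_range.1 hj)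
    · rw [← hcol j hj]
      exact sum_congr rfl fun i hi => hG i (mem_range.1 hi) j hj
    · rwa [growth_congr hG le_rfl le_rfl]
    · simp only [strips, Prod.mk.injEq]
      refine ⟨growingColumns_congr fun t ht k _ => ?_, growingColumns_congr fun t ht k _ => ?_⟩
      · rw [growth_congr hG le_rfl ht]
      · rw [growth_congr hG ht le_rfl]

/-! ### The reflection principle -/

section Reflection

variable {d : ℕ}

/-- `f` changes by the sign of the permutation when the coordinates are permuted. -/
def IsAlternating (f : (Fin d → ℤ) → ℤ) : Prop :=
  ∀ (τ : Equiv.Perm (Fin d)) (s : Fin d → ℤ), f (s ∘ τ) = Equiv.Perm.sign τ * f s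

theorem IsAlternating.eq_zero {f : (Fin d → ℤ) → ℤ} (hf : IsAlternating f) {s : Fin d → ℤ}
    {k l : Fin d} (hkl : k ≠ l) (hs : s k = s l) : f s = 0 := by
  have h := hf (Equiv.swap k l) s
  have hs' : s ∘ Equiv.swap k l = s := by
    ext j
    simp only [Function.comp_apply, Equiv.swap_apply_def]
    split_ifs with h1 h2
    · rw [h1, hs]
    · rw [h2, hs]
    · rfl
  rw [hs', Equiv.Perm.sign_swap hkl] at h
  simp at h
  omega

variable {W : Type*} [Fintype W] {δ : W → Fin d → ℤ}

/-- A set of steps (the range of `δ`) that is stable under permutations of the coordinates. -/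
def IsSymmetricSteps (δ : W → Fin d → ℤ) : Prop :=
  ∀ τ : Equiv.Perm (Fin d), ∃ e : W ≃ W, ∀ w, δ (e w) = δ w ∘ τ

/-- The sum over all endpoints of walks from `s` is again alternating in `s`. -/
theorem IsAlternating.sum_walks {f : (Fin d → ℤ) → ℤ} (hf : IsAlternating f)
    (hδ : IsSymmetricSteps δ) (m : ℕ) :
    IsAlternating fun s => ∑ v : Fin m → W, f (s + ∑ i, δ (v i)) := by
  intro τ s
  obtain ⟨e, he⟩ := hδ τ
  simp only [mul_sum, ← hf τ]
  refine (Fintype.sum_equiv (Equiv.piCongrRight fun _ : Fin m => e) _ _ fun v => ?_).symm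
  congr 1
  ext k
  simp [he, Finset.sum_apply]

open scoped Classical in
/-- The reflection principle of Gessel and Zeilberger. If no step changes the difference of two
coordinates by more than one, a walk that leaves the region `s 0 > s 1 > ⋯` has to visit a point
with two equal coordinates, and the walks that continue from such a point contribute `0` to the
sum of an alternating function. -/
theorem IsAlternating.sum_walks_eq {f : (Fin d → ℤ) → ℤ} (hf : IsAlternating f)
    (hδ : IsSymmetricSteps δ) (hjump : ∀ w k l, δ w l - δ w k ≤ 1) (m : ℕ) (s : Fin d → ℤ)
    (hs : StrictAnti s) : ∑ v : Fin m → W, f (s + ∑ i, δ (v i)) =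
      ∑ v : Fin m → W, if ∀ t : ℕ, StrictAnti (s + ∑ i with i.1 < t, δ (v i)) then
        f (s + ∑ i, δ (v i)) else 0 := by
  induction m generalizing s with
  | zero => simp [hs]
  | succ m ih =>
    rw [← (Fin.consEquiv fun _ => W).sum_comp, ← (Fin.consEquiv fun _ => W).sum_comp,
      Fintype.sum_prod_type, Fintype.sum_prod_type]
    refine sum_congr rfl fun w _ => ?_
    have hcons (u : Fin m → W) :
        (∀ t : ℕ, StrictAnti (s + ∑ i with i.1 < t, δ (Fin.consEquiv (fun _ => W) (w, u) i))) ↔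
          ∀ t : ℕ, StrictAnti (s + δ w + ∑ i with i.1 < t, δ (u i)) := by
      simp only [sum_filter, Fin.sum_univ_succ]
      constructor
      · intro h t
        simpa [add_assoc, Fin.consEquiv] using h (t + 1)
      · intro h t
        cases t with
        | zero => simpa using hs
        | succ t => simpa [add_assoc, Fin.consEquiv] using h t
    simp only [hcons]
    have hsum (u : Fin m → W) : s + ∑ i, δ (Fin.consEquiv (fun _ => W) (w, u) i) =
        s + δ w + ∑ i, δ (u i) := by
      simp [Fin.sum_univ_succ, Fin.consEquiv, add_assoc]
    simp only [hsum]
    by_cases hw : StrictAnti (s + δ w)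
    · exact ih _ hw
    · obtain ⟨k, l, hkl, hle⟩ : ∃ k l, k < l ∧ (s + δ w) k ≤ (s + δ w) l := by
        simpa [StrictAnti] using hw
      have heq : (s + δ w) k = (s + δ w) l := by
        have h1 := hs hkl
        have h2 := hjump w k l
        simp only [Pi.add_apply] at hle ⊢
        omega
      refine ((hf.sum_walks hδ m).eq_zero hkl.ne heq).trans (sum_eq_zero fun u _ => ?_).symm
      exact if_neg fun h => hw (by simpa using h 0)

end Reflection

/-! ### Signed counts of block walks -/

section BlockWalks

variable {n d r : ℕ}

/-- The sets of `r` columns, which are the possible blocks of a walk. -/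
abbrev Columns (d r : ℕ) : Type := {s : Finset (Fin d) // #s = r}

/-- The displacement of a block of positive steps. -/
def Columns.indicator (s : Columns d r) (k : Fin d) : ℤ := if k ∈ s.1 then 1 else 0

theorem isSymmetricSteps_indicator :
    IsSymmetricSteps (Columns.indicator : Columns d r → Fin d → ℤ) := fun τ =>
  ⟨(Equiv.finsetCongr τ.symm).subtypeEquiv fun s => by simp, fun s => by
    ext k; simp [Columns.indicator]⟩

theorem isSymmetricSteps_neg_indicator :
    IsSymmetricSteps fun s : Columns d r => -s.indicator := fun τ => by
  obtain ⟨e, he⟩ := isSymmetricSteps_indicator (r := r) τ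
  exact ⟨e, fun s => by simp only [he]; rfl⟩

theorem sum_indicator_eq (S : Fin n → Columns d r) (t : ℕ) (k : Fin d) :
    (∑ i with i.1 < t, (S i).indicator) k = content (fun i => (S i).1) t k := by
  rw [Finset.sum_apply]
  simp only [Columns.indicator, content]
  rw [sum_boole, filter_filter]
  simp

theorem sum_indicator_eq_content (S : Fin n → Columns d r) (k : Fin d) :
    (∑ i, (S i).indicator) k = content (fun i => (S i).1) n k := by
  rw [← sum_indicator_eq]
  simp

/-- The strictly decreasing start point of the walks, after a shift that makes the walls of the
dominant region the hyperplanes on which two coordinates agree. -/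
def startPoint (d : ℕ) (k : Fin d) : ℤ := -(k.1 : ℤ)

/-- The shift by `startPoint d` turns weakly decreasing integers into strictly decreasing ones. -/
theorem strictAnti_startPoint_add_iff {c : Fin d → ℤ} {x : ℕ → ℕ} (hc : ∀ k : Fin d, c k = x k)
    (hx : ∀ k, d ≤ k → x k = 0) : StrictAnti (startPoint d + c) ↔ Antitone x := by
  constructor
  · intro h
    refine antitone_nat_of_succ_le fun k => ?_
    by_cases hk : k + 1 < d
    · have := @h ⟨k, by omega⟩ ⟨k + 1, hk⟩ (by simp)
      simp only [Pi.add_apply, startPoint, hc] at this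
      push_cast at this
      omega
    · simp [hx _ (not_lt.1 hk)]
  · intro h k l hkl
    have h1 : x l ≤ x k := h (Fin.le_def.1 hkl.le)
    have h2 := Fin.lt_def.1 hkl
    simp only [Pi.add_apply, startPoint, hc]
    omega

/-- The alternating function that is `1` at `startPoint d` and vanishes at all other strictly
decreasing points. -/
def signedEndpoint (z : Fin d → ℤ) : ℤ :=
  ∑ π : Equiv.Perm (Fin d), if z = startPoint d ∘ π then (Equiv.Perm.sign π : ℤ) else 0

theorem isAlternating_signedEndpoint : IsAlternating (signedEndpoint (d := d)) := by
  intro τ s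
  rw [signedEndpoint, signedEndpoint, mul_sum]
  refine (Fintype.sum_equiv (Equiv.mulRight τ) _ _ fun π => ?_).symm
  have : s ∘ τ = startPoint d ∘ (Equiv.mulRight τ π : Equiv.Perm (Fin d)) ↔
      s = startPoint d ∘ π := by
    rw [Equiv.coe_mulRight, Equiv.Perm.coe_mul, ← Function.comp_assoc]
    exact τ.surjective.injective_comp_right.eq_iff
  rw [if_congr this rfl rfl]
  simp [mul_comm]

theorem signedEndpoint_of_strictAnti {z : Fin d → ℤ} (hz : StrictAnti z) :
    signedEndpoint z = if z = startPoint d then 1 else 0 := by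
  rw [signedEndpoint, Fintype.sum_eq_single 1]
  · simp
  · intro π hπ
    refine if_neg fun h => hπ ?_
    have hmono : StrictMono π := fun k l hkl => by
      have := hz hkl
      simp only [h, Function.comp_apply, startPoint] at this
      rw [Fin.lt_def]; omega
    ext k
    have : π = ⇑(1 : Equiv.Perm (Fin d)) := by
      refine (hmono.range_inj strictMono_id).1 ?_
      rw [π.surjective.range_eq, Set.range_id]
    rw [this]

/-- The rest of the second half of a walk after `t` blocks is an initial part of its reversal. -/
theorem sum_reverse (R : Fin n → Columns d r) (t : ℕ) :
    ∑ i, (R i).indicator - ∑ i with i.1 < t, (R i).indicator =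
      ∑ i : Fin n with i.1 < n - t, (R i.rev).indicator := by
  rw [← sum_filter_add_sum_filter_not univ (fun i : Fin n => i.1 < t), add_sub_cancel_left,
    sum_filter, sum_filter, ← Equiv.sum_comp Fin.revPerm]
  refine sum_congr rfl fun i _ => if_congr ?_ rfl rfl
  simp only [Fin.revPerm_apply, Fin.val_rev]
  omega

open scoped Classical in
/-- The signed count of all pairs of block walks, which start at the origin and whose endpoints
differ by a point `toeplitzPoint π`, is the count of the dominant pairs. The first walk and the
reversed second walk are concatenated, and the reflection principle is applied to each half. -/
theorem sum_sign_card_eq (n d r : ℕ) : ∑ π : Equiv.Perm (Fin d), (Equiv.Perm.sign π : ℤ) *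
      #{p : (Fin n → Columns d r) × (Fin n → Columns d r) |
        ∑ i, (p.1 i).indicator - ∑ i, (p.2 i).indicator = toeplitzPoint π} =
    (dominantPairs r n d).ncard := by
  have hend (S R : Fin n → Columns d r) (π : Equiv.Perm (Fin d)) :
      ∑ i, (S i).indicator - ∑ i, (R i).indicator = toeplitzPoint π ↔
        startPoint d + ∑ i, (S i).indicator + ∑ i, -(R i).indicator = startPoint d ∘ π := by
    simp only [funext_iff, Pi.add_apply, Pi.sub_apply, sum_neg_distrib, Pi.neg_apply,
      Function.comp_apply, startPoint, toeplitzPoint]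
    exact forall_congr' fun k => by constructor <;> intro h <;> linarith
  have hstart : StrictAnti (startPoint d) := fun k l hkl => by
    simpa [startPoint] using hkl
  have hdom (S : Fin n → Columns d r) :
      (∀ t : ℕ, StrictAnti (startPoint d + ∑ i with i.1 < t, (S i).indicator)) ↔
        IsDominant r fun i => (S i).1 := by
    refine (forall_congr' fun t => strictAnti_startPoint_add_iff (sum_indicator_eq S t)
      fun k => content_of_le _ t).trans ?_
    exact ⟨fun h => ⟨fun i => (S i).2, h⟩, fun h => h.2⟩
  have hcontent (S R : Fin n → Columns d r) : ∑ i, (S i).indicator = ∑ i, (R i).indicator ↔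
      content (fun i => (S i).1) n = content (fun i => (R i).1) n := by
    constructor
    · intro h
      ext k
      by_cases hk : k < d
      · have := congrFun h ⟨k, hk⟩
        rw [sum_indicator_eq_content, sum_indicator_eq_content] at this
        exact_mod_cast this
      · rw [content_of_le _ _ (not_lt.1 hk), content_of_le _ _ (not_lt.1 hk)]
    · intro h
      ext k
      rw [sum_indicator_eq_content, sum_indicator_eq_content, h]
  have hjump (s : Columns d r) (k l : Fin d) :
      s.indicator l - s.indicator k ≤ 1 ∧ -s.indicator l - -s.indicator k ≤ 1 := by
    simp only [Columns.indicator]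
    split_ifs <;> simp
  calc
    _ = ∑ S : Fin n → Columns d r, ∑ R : Fin n → Columns d r,
          signedEndpoint (startPoint d + ∑ i, (S i).indicator + ∑ i, -(R i).indicator) := by
      simp only [card_filter, hend, signedEndpoint, Nat.cast_sum, mul_sum, Fintype.sum_prod_type]
      rw [sum_comm]
      refine sum_congr rfl fun S _ => ?_
      rw [sum_comm]
      refine sum_congr rfl fun R _ => sum_congr rfl fun π _ => ?_
      split_ifs <;> simp
    _ = ∑ S : Fin n → Columns d r, if IsDominant r fun i => (S i).1 then
          ∑ R : Fin n → Columns d r,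
            signedEndpoint (startPoint d + ∑ i, (S i).indicator + ∑ i, -(R i).indicator)
          else 0 := by
      rw [(isAlternating_signedEndpoint.sum_walks isSymmetricSteps_neg_indicator n).sum_walks_eq
        isSymmetricSteps_indicator (fun s k l => (hjump s k l).1) n _ hstart]
      exact sum_congr rfl fun S _ => if_congr (hdom S) rfl rfl
    _ = ∑ S : Fin n → Columns d r, if IsDominant r fun i => (S i).1 then
          ∑ R : Fin n → Columns d r, if (IsDominant r fun i => (R i).1) ∧
            content (fun i => (S i).1) n = content (fun i => (R i).1) n then 1 else 0
          else 0 := by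
      refine sum_congr rfl fun S _ => ?_
      split_ifs with hS
      swap
      · rfl
      have hz : StrictAnti (startPoint d + ∑ i, (S i).indicator) :=
        (strictAnti_startPoint_add_iff (sum_indicator_eq_content S)
          fun k => content_of_le _ n).2 (hS.2 n)
      rw [isAlternating_signedEndpoint.sum_walks_eq isSymmetricSteps_neg_indicator
        (fun s k l => (hjump s k l).2) n _ hz,
        ← Equiv.sum_comp (Equiv.arrowCongr (Fin.revPerm (n := n)) (Equiv.refl (Columns d r)))]
      refine sum_congr rfl fun R _ => ?_
      have hrev (i : Fin n) :
          (Equiv.arrowCongr (Fin.revPerm (n := n)) (Equiv.refl (Columns d r))) R i = R i.rev := rfl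
      simp only [hrev, sum_neg_distrib, ← sub_eq_add_neg]
      have htot : ∑ i : Fin n, (R i.rev).indicator = ∑ i, (R i).indicator :=
        Equiv.sum_comp Fin.revPerm fun i => (R i).indicator
      by_cases hSR : ∑ i, (S i).indicator = ∑ i, (R i).indicator
      · have hpart (t : ℕ) : startPoint d + ∑ i, (S i).indicator -
            ∑ i : Fin n with i.1 < t, (R i.rev).indicator =
              startPoint d + ∑ i with i.1 < n - t, (R i).indicator := by
          have := sum_reverse (fun i => R i.rev) t
          simp only [Fin.rev_rev, htot] at this
          rw [add_sub_assoc, hSR, this]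
        simp only [hpart]
        have hstay : (∀ t : ℕ, StrictAnti (startPoint d + ∑ i with i.1 < n - t, (R i).indicator)) ↔
            IsDominant r fun i => (R i).1 := by
          rw [← hdom]
          constructor
          · intro h t
            rcases le_total t n with ht | ht
            · simpa [Nat.sub_sub_self ht] using h (n - t)
            · have hn (i : Fin n) : i.1 < t := i.2.trans_le ht
              simpa [hn] using h 0
          · exact fun h t => h (n - t)
        rw [htot, hSR, add_sub_cancel_right, signedEndpoint_of_strictAnti hstart, if_pos rfl]
        exact if_congr (by rw [hstay, ← hcontent]; simp [hSR]) rfl rfl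
      · refine Eq.trans ?_ (if_neg fun h => hSR ((hcontent S R).2 h.2)).symm
        split_ifs with h
        · have hn := h n
          simp only [Fin.is_lt, filter_true] at hn
          rw [signedEndpoint_of_strictAnti hn, if_neg fun h' => hSR ?_]
          rw [htot] at h'
          ext k
          have := congrFun h' k
          simp only [Pi.sub_apply, Pi.add_apply] at this
          linarith
        · rfl
    _ = #{p : (Fin n → Columns d r) × (Fin n → Columns d r) |
          ((fun i => (p.1 i).1), fun i => (p.2 i).1) ∈ dominantPairs r n d} := by
      simp only [card_filter, Nat.cast_sum, Fintype.sum_prod_type]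
      refine sum_congr rfl fun S _ => ?_
      split_ifs with hS
      · exact sum_congr rfl fun R _ => by simp [dominantPairs, hS]
      · exact (sum_eq_zero fun R _ => by simp [dominantPairs, hS]).symm
    _ = (dominantPairs r n d).ncard := by
      rw [← Set.ncard_coe_finset]
      congr 1
      refine Set.BijOn.ncard_eq (f := fun p => ((fun i => (p.1 i).1), fun i => (p.2 i).1))
        ⟨fun p hp => by simpa using hp, fun p _ q _ h => ?_, fun p hp => ?_⟩
      · simp only [Prod.mk.injEq, funext_iff] at h
        exact Prod.ext (funext fun i => Subtype.ext (h.1 i)) (funext fun i => Subtype.ext (h.2 i))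
      · exact ⟨(fun i => ⟨p.1 i, hp.1.1 i⟩, fun i => ⟨p.2 i, hp.2.1.1 i⟩), by simpa using hp, rfl⟩

end BlockWalks

/-! ### Lattice walks and their blocks -/

section LatticeWalks

variable {n d r : ℕ}

/-- Block and place in the block, in the first or the second half of a walk, determine the position
in the walk. -/
noncomputable def position (n r : ℕ) : (Fin n × Fin r) ⊕ (Fin n × Fin r) ≃ Fin (2 * (r * n)) :=
  Equiv.ofBijective (Sum.elim (fun p => firstHalf p.1 p.2) fun p => secondHalf p.1 p.2) <| by
    have key (p q : Fin n × Fin r) (h : r * p.1.1 + p.2.1 = r * q.1.1 + q.2.1) : p = q := by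
      have hr : 0 < r := p.2.pos
      have h1 : p.1.1 = q.1.1 := by
        have := congrArg (· / r) h
        simpa [Nat.mul_add_div hr, Nat.div_eq_of_lt p.2.2, Nat.div_eq_of_lt q.2.2] using this
      have h2 : p.2.1 = q.2.1 := by rw [h1] at h; omega
      exact Prod.ext (Fin.ext h1) (Fin.ext h2)
    refine (Fintype.bijective_iff_injective_and_card _).2 ⟨?_, ?_⟩
    · rintro (p | p) (q | q) h <;> simp only [Sum.elim_inl, Sum.elim_inr, firstHalf, secondHalf,
        Fin.mk.injEq] at h
      · rw [key p q h]
      · have := index_lt p.1 p.2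
        omega
      · have := index_lt q.1 q.2
        omega
      · rw [key p q (by omega)]
    · simp only [Fintype.card_sum, Fintype.card_prod, Fintype.card_fin]
      ring

theorem position_inl (i : Fin n) (s : Fin r) : position n r (.inl (i, s)) = firstHalf i s := rfl

theorem position_inr (i : Fin n) (s : Fin r) : position n r (.inr (i, s)) = secondHalf i s := rfl

/-- The steps of a walk with positive directions `a` and negative directions `b`. -/
def wordStep (a b : Fin n → Fin r → Fin d) : (Fin n × Fin r) ⊕ (Fin n × Fin r) → Fin d → ℤ :=
  Sum.elim (fun p => Pi.single (a p.1 p.2) 1) fun p => -Pi.single (b p.1 p.2) 1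

/-- The walk from the origin with positive directions `a` followed by negative directions `b`. -/
noncomputable def wordWalk (a b : Fin n → Fin r → Fin d) (t : Fin (2 * (r * n) + 1)) : Fin d → ℤ :=
  ∑ p with p.1 < t.1, wordStep a b ((position n r).symm p)

variable (a b : Fin n → Fin r → Fin d)

theorem wordWalk_zero : wordWalk a b 0 = 0 := by simp [wordWalk]

theorem step_wordWalk (p : Fin (2 * (r * n))) :
    step (wordWalk a b) p = wordStep a b ((position n r).symm p) := by
  rw [step, wordWalk, wordWalk, sub_eq_iff_eq_add']
  have : (univ.filter fun q : Fin (2 * (r * n)) => q.1 < p.succ.1) =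
      insert p (univ.filter fun q => q.1 < p.castSucc.1) := by
    ext q
    simp only [mem_filter, mem_insert, mem_univ, true_and, Fin.val_succ, Fin.val_castSucc,
      Fin.ext_iff]
    omega
  rw [this, sum_insert (by simp), add_comm]

theorem step_wordWalk_firstHalf (i : Fin n) (s : Fin r) :
    step (wordWalk a b) (firstHalf i s) = Pi.single (a i s) 1 := by
  rw [step_wordWalk, ← position_inl, Equiv.symm_apply_apply]; rfl

theorem step_wordWalk_secondHalf (i : Fin n) (s : Fin r) :
    step (wordWalk a b) (secondHalf i s) = -Pi.single (b i s) 1 := by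
  rw [step_wordWalk, ← position_inr, Equiv.symm_apply_apply]; rfl

theorem wordWalk_last : wordWalk a b (Fin.last _) =
    ∑ i, ∑ s, Pi.single (a i s) 1 - ∑ i, ∑ s, Pi.single (b i s) 1 := by
  simp only [wordWalk, Fin.val_last, Fin.is_lt, filter_true]
  rw [← (position n r).sum_comp]
  simp [wordStep, Fintype.sum_prod_type, sub_eq_add_neg]

theorem eq_wordWalk {w : Fin (2 * (r * n) + 1) → Fin d → ℤ} (h0 : w 0 = 0)
    (ha : ∀ i s, IsPosStep w (firstHalf i s) (a i s))
    (hb : ∀ i s, IsNegStep w (secondHalf i s) (b i s)) : w = wordWalk a b := by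
  have hstep (p) : step w p = step (wordWalk a b) p := by
    obtain ⟨q, rfl⟩ := (position n r).surjective p
    obtain ⟨i, s⟩ | ⟨i, s⟩ := q
    · rw [position_inl, step_wordWalk_firstHalf]; exact ha i s
    · rw [position_inr, step_wordWalk_secondHalf]; exact hb i s
  ext1 t
  induction t using Fin.induction with
  | zero => rw [h0, wordWalk_zero]
  | succ p ih =>
    have := hstep p
    rw [step, step, ih] at this
    exact sub_left_injective this

theorem single_ne_neg_single (k l : Fin d) : (Pi.single k 1 : Fin d → ℤ) ≠ -Pi.single l 1 := by
  intro h
  have := congrFun h k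
  simp only [Pi.single_eq_same, Pi.neg_apply, Pi.single_apply] at this
  split_ifs at this
  omega

theorem wordWalk_mem (ha : ∀ i, StrictMono (a i)) (hb : ∀ i, StrictMono (b i)) :
    wordWalk a b ∈ blockIncreasingWalks d r n (wordWalk a b (Fin.last _)) := by
  refine ⟨⟨⟨wordWalk_zero a b, rfl, fun p => ?_⟩, fun p q k l hp hq => ?_⟩, a, b,
    step_wordWalk_firstHalf a b, step_wordWalk_secondHalf a b, ha, hb⟩
  · rw [step_wordWalk]
    have (k : Fin d) : ∑ j, |(Pi.single k 1 : Fin d → ℤ) j| = 1 := by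
      rw [Fintype.sum_eq_single k fun j hj => by simp [hj]]
      simp
    rcases (position n r).symm p with p | p <;> simp [wordStep, this]
  · obtain ⟨x, rfl⟩ := (position n r).surjective p
    obtain ⟨y, rfl⟩ := (position n r).surjective q
    obtain ⟨i, s⟩ | ⟨i, s⟩ := x
    · obtain ⟨j, u⟩ | ⟨j, u⟩ := y
      · rw [IsNegStep, position_inl, step_wordWalk_firstHalf] at hq
        exact absurd hq (single_ne_neg_single _ _)
      · rw [position_inl, position_inr, Fin.lt_def]
        have := index_lt i s
        simp only [firstHalf, secondHalf]
        omega
    · rw [IsPosStep, position_inr, step_wordWalk_secondHalf] at hp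
      exact absurd hp.symm (single_ne_neg_single _ _)

/-- The increasing enumeration of the columns in each block. -/
def enumeration (S : Fin n → Columns d r) (i : Fin n) (s : Fin r) : Fin d :=
  (S i).1.orderEmbOfFin (S i).2 s

theorem enumeration_strictMono (S : Fin n → Columns d r) (i : Fin n) :
    StrictMono (enumeration S i) :=
  ((S i).1.orderEmbOfFin (S i).2).strictMono

theorem enumeration_injective :
    Function.Injective (enumeration : (Fin n → Columns d r) → Fin n → Fin r → Fin d) := by
  intro S R h
  ext i : 2
  rw [← coe_inj, ← range_orderEmbOfFin _ (S i).2, ← range_orderEmbOfFin _ (R i).2]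
  exact congrArg Set.range (congrFun h i)

theorem exists_enumeration_eq (ha : ∀ i, StrictMono (a i)) :
    ∃ S : Fin n → Columns d r, enumeration S = a := by
  refine ⟨fun i => ⟨univ.map ⟨a i, (ha i).injective⟩, by simp⟩, ?_⟩
  ext1 i
  exact (orderEmbOfFin_unique _ (fun s => by simp) (ha i)).symm

theorem sum_single_enumeration (S : Fin n → Columns d r) (i : Fin n) :
    ∑ s, Pi.single (enumeration S i s) 1 = (S i).indicator := by
  have : ∑ k ∈ (S i).1, (Pi.single k 1 : Fin d → ℤ) =
      ∑ s, Pi.single (enumeration S i s) 1 := by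
    conv_lhs => rw [← map_orderEmbOfFin_univ _ (S i).2, sum_map]
    rfl
  rw [← this]
  ext k
  simp [Columns.indicator, Pi.single_apply, Finset.sum_apply]

theorem ncard_blockIncreasingWalks (p : Fin d → ℤ) : (blockIncreasingWalks d r n p).ncard =
    #{q : (Fin n → Columns d r) × (Fin n → Columns d r) |
        ∑ i, (q.1 i).indicator - ∑ i, (q.2 i).indicator = p} := by
  have hlast (S R : Fin n → Columns d r) : wordWalk (enumeration S) (enumeration R) (Fin.last _) =
      ∑ i, (S i).indicator - ∑ i, (R i).indicator := by
    simp only [wordWalk_last, sum_single_enumeration]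
  rw [← Set.ncard_coe_finset]
  refine (Set.BijOn.ncard_eq (f := fun q => wordWalk (enumeration q.1) (enumeration q.2))
    ⟨fun q hq => ?_, fun q _ q' _ h => ?_, fun w hw => ?_⟩).symm
  · simp only [coe_filter, mem_univ, true_and, Set.mem_ofPred_eq] at hq
    rw [← hq, ← hlast]
    exact wordWalk_mem _ _ (enumeration_strictMono _) (enumeration_strictMono _)
  · have hinj : Function.Injective fun k : Fin d => (Pi.single k 1 : Fin d → ℤ) := fun k l h => by
      by_contra hkl
      have := congrFun h k
      simp [hkl] at this
    refine Prod.ext (enumeration_injective ?_) (enumeration_injective ?_)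
    · ext1 i
      ext1 s
      apply hinj
      have := congrArg (step · (firstHalf i s)) h
      simpa only [step_wordWalk_firstHalf] using this
    · ext1 i
      ext1 s
      apply hinj
      have := congrArg (step · (secondHalf i s)) h
      simpa only [step_wordWalk_secondHalf, neg_inj] using this
  · obtain ⟨⟨⟨h0, hp, -⟩, -⟩, a, b, ha, hb, ham, hbm⟩ := hw
    obtain ⟨S, rfl⟩ := exists_enumeration_eq a ham
    obtain ⟨R, rfl⟩ := exists_enumeration_eq b hbm
    obtain rfl := eq_wordWalk _ _ h0 ha hb
    exact ⟨(S, R), by simp [← hp, hlast], rfl⟩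

end LatticeWalks

/-! ### From tableaux to dominant sequences -/

/-- The number of columns weakly left of `k` that grow at step `t`. -/
def columnRank (x : ℕ → ℕ → ℕ) (t k : ℕ) : ℕ := #{k' ∈ range (k + 1) | x t k' < x (t + 1) k'}

theorem card_eq_sum_heights {C : Finset (ℕ × ℕ)} {d : ℕ} {f : ℕ → ℕ}
    (h : ∀ i k, (i, k) ∈ C ↔ k < d ∧ i < f k) : #C = ∑ k : Fin d, f k := by
  rw [← sum_range f, card_eq_sum_card_fiberwise (f := Prod.snd) (t := range d)
    fun c hc => mem_coe.2 (mem_range.2 ((h c.1 c.2).1 hc).1)]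
  refine sum_congr rfl fun k hk => ?_
  have : ({c ∈ C | c.2 = k} : Finset (ℕ × ℕ)) =
      (range (f k)).map ⟨(·, k), Prod.mk_left_injective k⟩ := by
    ext ⟨i, k'⟩
    simp only [mem_filter, h, mem_map, mem_range]
    constructor
    · rintro ⟨⟨-, hi⟩, rfl⟩
      exact ⟨i, hi, rfl⟩
    · rintro ⟨j, hj, hjk⟩
      obtain ⟨rfl, rfl⟩ := Prod.mk.inj hjk
      exact ⟨⟨mem_range.1 hk, hj⟩, rfl⟩
  rw [this, card_map, card_range]

namespace YoungTableau

section Height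

variable {N : ℕ} (T : YoungTableau (Icc 1 N))

/-- The height of column `k` in the tableau formed by the entries up to `v`. -/
def height (v k : ℕ) : ℕ := #{i ∈ range (T.shape.colLen k) | T.filling i k ≤ v}

variable {T}

theorem lt_height_iff {v i k : ℕ} : i < T.height v k ↔ (i, k) ∈ T.shape ∧ T.filling i k ≤ v := by
  rw [YoungDiagram.mem_iff_lt_colLen]
  exact lt_card_filter_range_iff fun i j hij hj h =>
    (T.filling.col_weak hij (YoungDiagram.mem_iff_lt_colLen.2 hj)).trans h

theorem filling_mem {i k : ℕ} (h : (i, k) ∈ T.shape) : 1 ≤ T.filling i k ∧ T.filling i k ≤ N := by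
  simpa using T.bijOn.mapsTo (x := (i, k)) (by simpa using h)

theorem exists_filling_eq {v : ℕ} (h1 : 1 ≤ v) (hN : v ≤ N) :
    ∃ i k, (i, k) ∈ T.shape ∧ T.filling i k = v := by
  obtain ⟨⟨i, k⟩, h, rfl⟩ := T.bijOn.surjOn (a := v) (by simp [h1, hN])
  exact ⟨i, k, by simpa using h, rfl⟩

theorem filling_injective {i k i' k' : ℕ} (h : (i, k) ∈ T.shape) (h' : (i', k') ∈ T.shape)
    (heq : T.filling i k = T.filling i' k') : i = i' ∧ k = k' :=
  Prod.mk.inj (T.bijOn.injOn (by simpa using h) (by simpa using h') heq)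

theorem filling_mono {i k i' k' : ℕ} (h : (i', k') ∈ T.shape) (hi : i ≤ i') (hk : k ≤ k') :
    T.filling i k ≤ T.filling i' k' :=
  (T.filling.row_weak_of_le hk (T.shape.up_left_mem hi le_rfl h)).trans (T.filling.col_weak hi h)

theorem height_mono {v w : ℕ} (h : v ≤ w) (k : ℕ) : T.height v k ≤ T.height w k :=
  le_of_forall_lt fun i hi => by
    rw [lt_height_iff] at hi ⊢
    exact ⟨hi.1, hi.2.trans h⟩

theorem height_antitone (v : ℕ) : Antitone (T.height v) := fun k k' hk =>
  le_of_forall_lt fun i hi => by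
    rw [lt_height_iff] at hi ⊢
    exact ⟨T.shape.up_left_mem le_rfl hk hi.1, (filling_mono hi.1 le_rfl hk).trans hi.2⟩

theorem height_zero (k : ℕ) : T.height 0 k = 0 := by
  by_contra h
  obtain ⟨h1, h2⟩ := lt_height_iff.1 (Nat.pos_of_ne_zero h)
  have := filling_mem h1
  omega

theorem lt_of_mem_shape {d : ℕ} (hd : T.numCols ≤ d) {i k : ℕ} (h : (i, k) ∈ T.shape) : k < d :=
  (YoungDiagram.mem_iff_lt_rowLen.1 (T.shape.up_left_mem (Nat.zero_le i) le_rfl h)).trans_le hd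

theorem height_of_le {d : ℕ} (hd : T.numCols ≤ d) (v : ℕ) {k : ℕ} (hk : d ≤ k) :
    T.height v k = 0 := by
  by_contra h
  have := lt_of_mem_shape hd (lt_height_iff.1 (Nat.pos_of_ne_zero h)).1
  omega

theorem lt_height_max_iff {i k : ℕ} : i < T.height N k ↔ (i, k) ∈ T.shape :=
  lt_height_iff.trans (and_iff_left_of_imp fun h => (filling_mem h).2)

theorem sum_height {d : ℕ} (hd : T.numCols ≤ d) {v : ℕ} (hv : v ≤ N) :
    ∑ k : Fin d, T.height v k = v := by
  rw [← card_eq_sum_heights (C := {c ∈ T.shape.cells | T.filling c.1 c.2 ≤ v})]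
  · have : #(Icc 1 v) = v := by simp
    conv_rhs => rw [← this]
    refine card_bij (fun c _ => T.filling c.1 c.2) (fun c hc => ?_) (fun c hc c' hc' h => ?_)
      fun w hw => ?_
    · simp only [mem_filter, YoungDiagram.mem_cells] at hc
      exact mem_Icc.2 ⟨(filling_mem hc.1).1, hc.2⟩
    · simp only [mem_filter, YoungDiagram.mem_cells] at hc hc'
      have := filling_injective hc.1 hc'.1 h
      exact Prod.ext this.1 this.2
    · rw [mem_Icc] at hw
      obtain ⟨i, k, h, rfl⟩ := exists_filling_eq (T := T) hw.1 (hw.2.trans hv)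
      exact ⟨(i, k), by simp [h, hw.2], rfl⟩
  · intro i k
    simp only [mem_filter, YoungDiagram.mem_cells, lt_height_iff]
    exact ⟨fun h => ⟨lt_of_mem_shape hd h.1, h⟩, fun h => h.2⟩

theorem ext_of_filling {T T' : YoungTableau (Icc 1 N)} (h : T.shape = T'.shape)
    (hf : ∀ i k, (i, k) ∈ T.shape → T.filling i k = T'.filling i k) : T = T' := by
  obtain ⟨μ, F, hF⟩ := T
  obtain ⟨μ', F', hF'⟩ := T'
  obtain rfl : μ = μ' := h
  obtain rfl : F = F' := by
    ext i k
    by_cases hc : (i, k) ∈ μ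
    · exact hf i k hc
    · rw [F.zeros hc, F'.zeros hc]
  rfl

theorem shape_eq_iff {T T' : YoungTableau (Icc 1 N)} :
    T.shape = T'.shape ↔ T.height N = T'.height N := by
  constructor
  · intro h
    ext k
    exact eq_of_forall_lt_iff fun i => by rw [lt_height_max_iff, lt_height_max_iff, h]
  · intro h
    ext ⟨i, k⟩
    rw [YoungDiagram.mem_cells, YoungDiagram.mem_cells, ← lt_height_max_iff, ← lt_height_max_iff, h]

end Height

section Block

variable {r n d : ℕ} {T : YoungTableau (Icc 1 (r * n))}

/-- Inside a block, the rows of the entries weakly decrease; the definition gives this for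
consecutive entries. -/
theorem BlockCondition.row_le (hT : T.BlockCondition r n) {t : ℕ} (ht : t < n) {i k i' k' : ℕ}
    (hc : (i, k) ∈ T.shape) (hc' : (i', k') ∈ T.shape) (h1 : r * t < T.filling i k)
    (h2 : T.filling i k ≤ T.filling i' k') (h3 : T.filling i' k' ≤ r * (t + 1)) : i' ≤ i := by
  obtain ⟨m, hm⟩ := Nat.exists_eq_add_of_le h2
  induction m generalizing i' k' with
  | zero => exact (filling_injective hc' hc hm).1.le
  | succ m ih =>
    have hN := (filling_mem hc').2
    rw [Nat.mul_succ] at h3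
    obtain ⟨j, l, hj, hjl⟩ := exists_filling_eq (T := T) (v := T.filling i k + m) (by omega)
      (by omega)
    refine le_trans ?_ (ih hj (by omega) (by rw [Nat.mul_succ]; omega) hjl)
    refine hT (t + 1) (T.filling j l - r * t) (by omega) ht (by omega) (by omega) i' j
      ⟨k', hc', ?_⟩ ⟨l, hj, ?_⟩ <;> rw [Nat.add_sub_cancel] <;> omega

/-- No column receives two entries of one block, as the lower one would be the larger one. -/
theorem isStripSeq_height (hd : T.numCols ≤ d) (hT : T.BlockCondition r n) :
    IsStripSeq n d fun t => T.height (r * t) where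
  zero k := by simp [height_zero]
  le_succ t _ k := height_mono (Nat.mul_le_mul_left r t.le_succ) k
  succ_le t ht k := by
    by_contra! h
    obtain ⟨h1, h2⟩ := lt_height_iff.1 h
    set i := T.height (r * t) k with hi
    have h3 : (i, k) ∈ T.shape := T.shape.up_left_mem i.le_succ le_rfl h1
    have h4 : r * t < T.filling i k := by
      by_contra h'
      exact lt_irrefl i (lt_height_iff.2 ⟨h3, not_lt.1 h'⟩)
    have := hT.row_le ht h3 h1 h4 (T.filling.col_weak i.le_succ h1) h2
    omega
  eq_zero t _ k hk := height_of_le hd _ hk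

/-- A block fills its columns from left to right. -/
theorem filling_eq (hd : T.numCols ≤ d) (hT : T.BlockCondition r n) {t i k : ℕ} (ht : t < n)
    (hc : (i, k) ∈ T.shape) (h1 : r * t < T.filling i k) (h2 : T.filling i k ≤ r * (t + 1)) :
    T.filling i k = r * t + columnRank (fun t => T.height (r * t)) t k := by
  have hN := (filling_mem hc).2
  have hk := lt_of_mem_shape hd hc
  -- The entries of the block up to the one in column `k` lie in the growing columns `k' ≤ k`.
  have key (k' : ℕ) : T.height (T.filling i k) k' = T.height (r * t) k' +
      if k' ≤ k ∧ T.height (r * t) k' < T.height (r * (t + 1)) k' then 1 else 0 := by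
    have hx := (isStripSeq_height hd hT).succ_le t ht k'
    have hl := height_mono (T := T) h1.le k'
    have hu := height_mono (T := T) h2 k'
    set h := T.height (r * t) k' with hh
    by_cases hgrow : h < T.height (r * (t + 1)) k'
    · obtain ⟨hmem, hle⟩ := lt_height_iff.1 hgrow
      have hgt : r * t < T.filling h k' := by
        by_contra h'
        exact lt_irrefl h (lt_height_iff.2 ⟨hmem, not_lt.1 h'⟩)
      have : h < T.height (T.filling i k) k' ↔ k' ≤ k := by
        rw [lt_height_iff, and_iff_right hmem]
        constructor
        · intro hle'
          by_contra! hkk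
          have := hT.row_le ht hmem hc hgt hle' h2
          have := filling_injective hc hmem (le_antisymm (filling_mono hmem this hkk.le) hle')
          omega
        · intro hkk
          by_contra! hlt
          have := hT.row_le ht hc hmem h1 hlt.le hle
          exact absurd (filling_mono hc this hkk) (not_le.2 hlt)
      by_cases hkk : k' ≤ k
      · rw [if_pos ⟨hkk, hgrow⟩]
        have := this.2 hkk
        omega
      · rw [if_neg fun h => hkk h.1]
        have := mt this.1 hkk
        omega
    · rw [if_neg fun h => hgrow h.2]
      omega
  have hs1 := sum_height hd hN
  have hs2 := sum_height hd (h1.le.trans hN)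
  -- The cells with entries up to `v` are `v` in number, here with `v` the entry and `v = r * t`.
  simp only [key, sum_add_distrib] at hs1
  rw [hs2] at hs1
  rw [← hs1, columnRank, ← sum_range (fun k' => if k' ≤ k ∧ T.height (r * t) k' <
    T.height (r * (t + 1)) k' then 1 else 0), ← card_filter]
  congr 2
  ext k'
  simp only [mem_filter, mem_range]
  exact ⟨fun h => ⟨by omega, h.2.2⟩, fun h => ⟨by omega, by omega, h.2⟩⟩

theorem exists_block {i k : ℕ} (hc : (i, k) ∈ T.shape) :
    ∃ t < n, r * t < T.filling i k ∧ T.filling i k ≤ r * (t + 1) := by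
  obtain ⟨h1, hN⟩ := filling_mem hc
  have hr : 0 < r := Nat.pos_of_ne_zero fun h => by simp [h] at hN; omega
  have hdiv := Nat.div_add_mod (T.filling i k - 1) r
  have hmod := Nat.mod_lt (T.filling i k - 1) hr
  refine ⟨(T.filling i k - 1) / r, (Nat.div_lt_iff_lt_mul hr).2 ?_, by omega, ?_⟩
  · have := mul_comm r n; omega
  · rw [Nat.mul_succ]; omega

theorem eq_of_height_eq {T' : YoungTableau (Icc 1 (r * n))} (hd : T.numCols ≤ d)
    (hT : T.BlockCondition r n) (hd' : T'.numCols ≤ d) (hT' : T'.BlockCondition r n)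
    (h : ∀ t ≤ n, T.height (r * t) = T'.height (r * t)) : T = T' := by
  refine ext_of_filling (shape_eq_iff.2 (h n le_rfl)) fun i k hc => ?_
  obtain ⟨t, ht, h1, h2⟩ := exists_block hc
  have h3 : i < T'.height (r * (t + 1)) k := h (t + 1) ht ▸ lt_height_iff.2 ⟨hc, h2⟩
  have h4 : ¬ i < T'.height (r * t) k := h t ht.le ▸ fun h => by
    have := (lt_height_iff.1 h).2
    omega
  obtain ⟨hc', h2'⟩ := lt_height_iff.1 h3
  have h1' : r * t < T'.filling i k := by
    by_contra h'
    exact h4 (lt_height_iff.2 ⟨hc', not_lt.1 h'⟩)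
  rw [filling_eq hd hT ht hc h1 h2, filling_eq hd' hT' ht hc' h1' h2']
  simp only [columnRank, h t ht.le, h (t + 1) ht]

end Block

end YoungTableau

/-! ### From dominant sequences to tableaux -/

section OfSequence

variable {r n d : ℕ} {S : Fin n → Finset (Fin d)}

/-- The block in which the cell `(i, k)` is added; junk if the cell is never added. -/
noncomputable def entryBlock (S : Fin n → Finset (Fin d)) (i k : ℕ) : ℕ :=
  sInf {t | i < content S (t + 1) k}

theorem entryBlock_spec {i k : ℕ} (h : i < content S n k) : entryBlock S i k < n ∧
    content S (entryBlock S i k) k = i ∧ i < content S (entryBlock S i k + 1) k := by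
  have hn : n ≠ 0 := by rintro rfl; simp [content_zero] at h
  have hne : n - 1 ∈ {t | i < content S (t + 1) k} := by
    rwa [Set.mem_ofPred_eq, show n - 1 + 1 = n by omega]
  have hmem : i < content S (entryBlock S i k + 1) k := Nat.sInf_mem ⟨_, hne⟩
  have hle : entryBlock S i k ≤ n - 1 := Nat.sInf_le hne
  have hnot : content S (entryBlock S i k) k ≤ i := by
    by_contra! hlt
    cases ht : entryBlock S i k with
    | zero => simp [ht, content_zero] at hlt
    | succ t =>
      rw [ht] at hlt
      have : entryBlock S i k ≤ t := Nat.sInf_le hlt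
      omega
  have := content_succ_le S (entryBlock S i k) k
  exact ⟨by omega, by omega, hmem⟩

theorem entryBlock_lt_iff {i k t : ℕ} (h : i < content S n k) :
    entryBlock S i k < t ↔ i < content S t k := by
  obtain ⟨-, h2, h3⟩ := entryBlock_spec h
  constructor
  · exact fun ht => h3.trans_le (content_mono S k ht)
  · intro hi
    by_contra! ht
    have : content S t k ≤ content S (entryBlock S i k) k := content_mono S k ht
    omega

theorem columnRank_lt {x : ℕ → ℕ → ℕ} {t k k' : ℕ} (hk : k < k') (h : x t k' < x (t + 1) k') :
    columnRank x t k < columnRank x t k' := by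
  refine card_lt_card (ssubset_iff_of_subset ?_ |>.2 ⟨k', ?_, ?_⟩)
  · exact filter_subset_filter _ (range_subset_range.2 (by omega))
  · simp [h]
  · simp only [mem_filter, mem_range]; omega

theorem columnRank_mono {x : ℕ → ℕ → ℕ} {t k k' : ℕ} (hk : k ≤ k') :
    columnRank x t k ≤ columnRank x t k' :=
  card_le_card (filter_subset_filter _ (range_subset_range.2 (by omega)))

theorem columnRank_pos {x : ℕ → ℕ → ℕ} {t k : ℕ} (h : x t k < x (t + 1) k) :
    0 < columnRank x t k :=
  card_pos.2 ⟨k, by simp [h]⟩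

theorem columnRank_content_le (hS : IsDominant r S) {t : ℕ} (ht : t < n) (k : ℕ) :
    columnRank (content S) t k ≤ r := by
  rw [← hS.1 ⟨t, ht⟩, ← card_map Fin.valEmbedding]
  refine card_le_card fun k' hk' => ?_
  have hlt := (mem_filter.1 hk').2
  have hd : k' < d := by
    by_contra h
    simp [content_of_le S _ (not_lt.1 h)] at hlt
  have := content_succ S ⟨t, ht⟩ ⟨k', hd⟩
  simp only at this
  split_ifs at this with hmem
  · exact mem_map.2 ⟨_, hmem, rfl⟩
  · omega

/-- The entry of the cell `(i, k)`: the blocks are numbered in turn, each one from left to right. -/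
noncomputable def seqEntry (r : ℕ) (S : Fin n → Finset (Fin d)) (i k : ℕ) : ℕ :=
  if i < content S n k then
    r * entryBlock S i k + columnRank (content S) (entryBlock S i k) k else 0

theorem seqEntry_spec (hS : IsDominant r S) {i k : ℕ} (h : i < content S n k) :
    seqEntry r S i k = r * entryBlock S i k + columnRank (content S) (entryBlock S i k) k ∧
      r * entryBlock S i k < seqEntry r S i k ∧
        seqEntry r S i k ≤ r * (entryBlock S i k + 1) := by
  obtain ⟨h1, h2, h3⟩ := entryBlock_spec h
  have hr := columnRank_content_le hS h1 k
  have hpos := columnRank_pos (x := content S) (t := entryBlock S i k) (k := k) (by omega)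
  rw [seqEntry, if_pos h, Nat.mul_succ]
  omega

theorem entryBlock_eq (hS : IsDominant r S) {i k t : ℕ} (h : i < content S n k)
    (h1 : r * t < seqEntry r S i k) (h2 : seqEntry r S i k ≤ r * (t + 1)) :
    entryBlock S i k = t := by
  obtain ⟨-, h3, h4⟩ := seqEntry_spec hS h
  have h5 := lt_of_mul_lt_mul_left' (h1.trans_le h4)
  have h6 := lt_of_mul_lt_mul_left' (h3.trans_le h2)
  omega

/-- The Young diagram with column heights `content S n`. -/
def seqShape (S : Fin n → Finset (Fin d)) (hS : IsDominant r S) : YoungDiagram where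
  cells := {c ∈ range n ×ˢ range d | c.1 < content S n c.2}
  isLowerSet := by
    rintro ⟨i, k⟩ ⟨i', k'⟩ ⟨hi, hk⟩ h
    simp only [coe_filter, mem_product, mem_range, Set.mem_ofPred_eq] at h ⊢
    have : content S n k ≤ content S n k' := hS.2 n hk
    simp only at hi hk
    omega

theorem mem_seqShape (hS : IsDominant r S) {i k : ℕ} :
    (i, k) ∈ seqShape S hS ↔ i < content S n k := by
  rw [← YoungDiagram.mem_cells]
  simp only [seqShape, mem_filter, mem_product, mem_range, and_iff_right_iff_imp]
  refine fun h => ⟨h.trans_le (content_le S n k), ?_⟩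
  by_contra hk
  simp [content_of_le S _ (not_lt.1 hk)] at h

theorem card_seqShape (hS : IsDominant r S) : #(seqShape S hS).cells = r * n := by
  rw [card_eq_sum_heights (f := content S n) (d := d), sum_content hS.1 le_rfl]
  intro i k
  rw [YoungDiagram.mem_cells, mem_seqShape]
  refine ⟨fun h => ⟨?_, h⟩, fun h => h.2⟩
  by_contra hk
  simp [content_of_le S _ (not_lt.1 hk)] at h

/-- The filling of `seqShape` with the entries `seqEntry`. -/
noncomputable def seqFilling (S : Fin n → Finset (Fin d)) (hS : IsDominant r S) :
    SemistandardYoungTableau (seqShape S hS) where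
  entry := seqEntry r S
  row_weak' {i k k'} hk hc := by
    rw [mem_seqShape] at hc
    have hc' : i < content S n k := hc.trans_le (hS.2 n hk.le)
    have hb : entryBlock S i k ≤ entryBlock S i k' := by
      refine Nat.lt_succ_iff.1 ((entryBlock_lt_iff hc').2 ?_)
      exact (entryBlock_spec hc).2.2.trans_le (hS.2 _ hk.le)
    obtain ⟨h1, -, h3⟩ := seqEntry_spec hS hc'
    obtain ⟨h4, h5, -⟩ := seqEntry_spec hS hc
    rcases hb.eq_or_lt with hb | hb
    · rw [h1, h4, hb]
      exact Nat.add_le_add_left (columnRank_mono hk.le) _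
    · have := Nat.mul_le_mul_left r hb
      rw [Nat.succ_eq_add_one] at this
      omega
  col_strict' {i i' k} hi hc := by
    rw [mem_seqShape] at hc
    have hc' : i < content S n k := hi.trans hc
    have hb : entryBlock S i k < entryBlock S i' k := by
      rw [entryBlock_lt_iff hc', (entryBlock_spec hc).2.1]
      exact hi
    obtain ⟨-, -, h3⟩ := seqEntry_spec hS hc'
    obtain ⟨-, h5, -⟩ := seqEntry_spec hS hc
    have := Nat.mul_le_mul_left r hb
    rw [Nat.succ_eq_add_one] at this
    omega
  zeros' hc := by
    rw [mem_seqShape] at hc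
    exact if_neg hc

theorem seqEntry_injective (hS : IsDominant r S) {i k i' k' : ℕ} (h : i < content S n k)
    (h' : i' < content S n k') (heq : seqEntry r S i k = seqEntry r S i' k') :
    i = i' ∧ k = k' := by
  obtain ⟨h1, -, -⟩ := seqEntry_spec hS h
  obtain ⟨h4, h5, h6⟩ := seqEntry_spec hS h'
  obtain ⟨-, h7, h8⟩ := entryBlock_spec h
  obtain ⟨-, h9, h10⟩ := entryBlock_spec h'
  have hb := entryBlock_eq hS h (heq ▸ h5) (heq ▸ h6)
  rw [hb] at h1 h7 h8
  -- Inside one block, the rank among the growing columns determines the column.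
  obtain rfl : k = k' := by
    rcases lt_trichotomy k k' with hk | hk | hk
    · have := columnRank_lt (x := content S) hk (t := entryBlock S i' k') (by omega)
      omega
    · exact hk
    · have := columnRank_lt (x := content S) hk (t := entryBlock S i' k') (by omega)
      omega
  exact ⟨h7.symm.trans h9, rfl⟩

/-- The standard Young tableau of a dominant sequence. -/
noncomputable def seqTableau (S : Fin n → Finset (Fin d)) (hS : IsDominant r S) :
    YoungTableau (Icc 1 (r * n)) where
  shape := seqShape S hS
  filling := seqFilling S hS
  bijOn := by
    have hmaps : Set.MapsTo (fun c : ℕ × ℕ => seqEntry r S c.1 c.2)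
        ((seqShape S hS).cells : Set (ℕ × ℕ)) (Icc 1 (r * n) : Set ℕ) := by
      rintro ⟨i, k⟩ hc
      rw [mem_coe, YoungDiagram.mem_cells, mem_seqShape] at hc
      obtain ⟨-, h2, h3⟩ := seqEntry_spec hS hc
      have := Nat.mul_le_mul_left r (entryBlock_spec hc).1
      rw [Nat.succ_eq_add_one] at this
      simp only [coe_Icc, Set.mem_Icc]
      omega
    have hinj : Set.InjOn (fun c : ℕ × ℕ => seqEntry r S c.1 c.2)
        ((seqShape S hS).cells : Set (ℕ × ℕ)) := by
      rintro ⟨i, k⟩ hc ⟨i', k'⟩ hc' heq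
      rw [mem_coe, YoungDiagram.mem_cells, mem_seqShape] at hc hc'
      have := seqEntry_injective hS hc hc' heq
      exact Prod.ext this.1 this.2
    exact ⟨hmaps, hinj, surjOn_of_injOn_of_card_le _ hmaps hinj (by simp [card_seqShape])⟩

theorem seqTableau_numCols_le (hS : IsDominant r S) : (seqTableau S hS).numCols ≤ d := by
  by_contra! h
  have : (0, d) ∈ seqShape S hS := YoungDiagram.mem_iff_lt_rowLen.2 h
  rw [mem_seqShape, content_of_le S n le_rfl] at this
  omega

theorem seqTableau_blockCondition (hS : IsDominant r S) :
    (seqTableau S hS).BlockCondition r n := by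
  rintro i s hi hin hs hsr k l ⟨j', hc', h'⟩ ⟨j, hc, h⟩
  obtain ⟨t, rfl⟩ : ∃ t, i = t + 1 := ⟨i - 1, by omega⟩
  rw [Nat.add_sub_cancel] at h h'
  replace hc := (mem_seqShape hS).1 hc
  replace hc' := (mem_seqShape hS).1 hc'
  replace h : seqEntry r S l j = r * t + s := h
  replace h' : seqEntry r S k j' = r * t + s + 1 := h'
  have hb := entryBlock_eq hS hc (t := t) (by omega) (by rw [Nat.mul_succ]; omega)
  have hb' := entryBlock_eq hS hc' (t := t) (by omega) (by rw [Nat.mul_succ]; omega)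
  obtain ⟨h1, -, -⟩ := seqEntry_spec hS hc
  obtain ⟨h1', -, -⟩ := seqEntry_spec hS hc'
  obtain ⟨-, h2, -⟩ := entryBlock_spec hc
  obtain ⟨-, h2', -⟩ := entryBlock_spec hc'
  rw [hb] at h1 h2
  rw [hb'] at h1' h2'
  have hjj : j ≤ j' := by
    by_contra! hlt
    have := columnRank_mono (x := content S) (t := t) hlt.le
    omega
  have := hS.2 t hjj
  omega

theorem height_seqTableau (hS : IsDominant r S) {t : ℕ} (ht : t ≤ n) :
    (seqTableau S hS).height (r * t) = content S t := by
  ext k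
  refine eq_of_forall_lt_iff fun i => ?_
  rw [YoungTableau.lt_height_iff]
  change (i, k) ∈ seqShape S hS ∧ seqEntry r S i k ≤ r * t ↔ _
  rw [mem_seqShape]
  constructor
  · rintro ⟨hc, hle⟩
    rw [← entryBlock_lt_iff hc]
    exact lt_of_mul_lt_mul_left' ((seqEntry_spec hS hc).2.1.trans_le hle)
  · intro h
    have hc : i < content S n k := h.trans_le (content_mono S k ht)
    rw [← entryBlock_lt_iff hc] at h
    exact ⟨hc, (seqEntry_spec hS hc).2.2.trans (Nat.mul_le_mul_left r h)⟩

end OfSequence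

/-- The columns of the entries in each of the `n` blocks of a tableau. -/
def blockColumns (r n d : ℕ) (T : YoungTableau (Icc 1 (r * n))) : Fin n → Finset (Fin d) :=
  growingColumns n d fun t => T.height (r * t)

section BlockColumns

variable {r n d : ℕ} {T : YoungTableau (Icc 1 (r * n))}

theorem content_blockColumns (hd : T.numCols ≤ d) (hT : T.BlockCondition r n) {t : ℕ}
    (ht : t ≤ n) : content (blockColumns r n d T) t = T.height (r * t) :=
  (YoungTableau.isStripSeq_height hd hT).content_growingColumns ht

theorem isDominant_blockColumns (hd : T.numCols ≤ d) (hT : T.BlockCondition r n) :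
    IsDominant r (blockColumns r n d T) :=
  (YoungTableau.isStripSeq_height hd hT).isDominant (fun _ _ => YoungTableau.height_antitone _)
    fun _ ht => YoungTableau.sum_height hd (Nat.mul_le_mul_left r ht)

theorem blockColumns_seqTableau {S : Fin n → Finset (Fin d)} (hS : IsDominant r S) :
    blockColumns r n d (seqTableau S hS) = S := by
  refine Eq.trans (growingColumns_congr fun t ht k _ => ?_) (growingColumns_content S)
  rw [height_seqTableau hS ht]

end BlockColumns

theorem ncard_tableauPairs (r n d : ℕ) :
    (tableauPairs r n d).ncard = (dominantPairs r n d).ncard := by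
  refine Set.BijOn.ncard_eq (f := fun p => (blockColumns r n d p.1, blockColumns r n d p.2))
    ⟨?_, ?_, ?_⟩
  · rintro p ⟨hs, hd1, hd2, hb1, hb2⟩
    refine ⟨isDominant_blockColumns hd1 hb1, isDominant_blockColumns hd2 hb2, ?_⟩
    rw [content_blockColumns hd1 hb1 le_rfl, content_blockColumns hd2 hb2 le_rfl]
    exact YoungTableau.shape_eq_iff.1 hs
  · rintro p ⟨-, hd1, hd2, hb1, hb2⟩ q ⟨-, hd1', hd2', hb1', hb2'⟩ h
    simp only [Prod.mk.injEq] at h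
    refine Prod.ext (YoungTableau.eq_of_height_eq hd1 hb1 hd1' hb1' fun t ht => ?_)
      (YoungTableau.eq_of_height_eq hd2 hb2 hd2' hb2' fun t ht => ?_)
    · rw [← content_blockColumns hd1 hb1 ht, ← content_blockColumns hd1' hb1' ht, h.1]
    · rw [← content_blockColumns hd2 hb2 ht, ← content_blockColumns hd2' hb2' ht, h.2]
  · rintro p ⟨h1, h2, h⟩
    refine ⟨(seqTableau p.1 h1, seqTableau p.2 h2), ⟨?_, seqTableau_numCols_le h1,
      seqTableau_numCols_le h2, seqTableau_blockCondition h1, seqTableau_blockCondition h2⟩, ?_⟩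
    · rw [YoungTableau.shape_eq_iff, height_seqTableau h1 le_rfl, height_seqTableau h2 le_rfl, h]
    · exact Prod.ext (blockColumns_seqTableau h1) (blockColumns_seqTableau h2)

end PlanarSubgraph

theorem theorem4 (n d r : ℕ) (hn : 0 < n) (hd : 0 < d) (hr : 0 < r) :
    PlanarSubgraph.gHat r n d = (PlanarSubgraph.tableauPairs r n d).ncard ∧
    (PlanarSubgraph.gHat r n d : ℤ) =
      ∑ π : Equiv.Perm (Fin d), (Equiv.Perm.sign π : ℤ) *
        ((PlanarSubgraph.blockIncreasingWalks d r n
          (PlanarSubgraph.toeplitzPoint π)).ncard : ℤ) := by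
  refine ⟨?_, ?_⟩
  · rw [PlanarSubgraph.gHat_eq, PlanarSubgraph.ncard_tableauPairs]
  · rw [PlanarSubgraph.gHat_eq, ← PlanarSubgraph.sum_sign_card_eq]
    simp only [PlanarSubgraph.ncard_blockIncreasingWalks]
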